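/- Let $\mathcal D=(A,X,Y,(\alpha_i)_{i\in I},(\alpha_i^\vee)_{i\in I})$ be a Kac--Moody root datum: $I$ is a finite set, $A=(a_{ij})$ is a generalized Cartan matrix over $I$, $X$ and $Y$ are free $\mathbb Z$-modules of finite rank in perfect duality $\langle\,,\rangle$, the families $(\alpha_i)$ in $X$ and $(\alpha_i^\vee)$ in $Y$ are linearly independent, and $\langle\alpha_i^\vee,\alpha_j\rangle=a_{ij}$. Let $W^v$ be the Weyl group generated by the reflections $r_i:x\mapsto x-\langle\alpha_i^\vee,x\rangle\alpha_i$ of $X$, acting contragrediently on $Y$, with its length $\ell$ and its Bruhat order. Let $\Phi=W^v\{\alpha_i\}$ be the set of real roots, $\Phi_+=\Phi\cap\bigoplus_i\mathbb N\alpha_i$; for $\beta=w\alpha_i\in\Phi$ put $\beta^\vee=w\alpha_i^\vee$ and $s_\beta=wr_iw^{-1}$. A root $\beta\in\Phi_+$ is called quantum if $\langle\beta^\vee,\gamma\rangle=1$ for every $\gamma\in\Phi_+\setminus\{\beta\}$ with $s_\beta\gamma\in-\Phi_+$. Let $Y^{++}=\{\lambda\in Y\mid\langle\lambda,\alpha_i\rangle\ge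 0\ \forall i\}$, $Y^+=\bigcup_{w\in W^v}wY^{++}$, and $W^+=Y^+\rtimes W^v\subseteq Y\rtimes W^v$, with elements written $\varpi^\lambda w$. The group $Y\rtimes W^v$ acts on $\Phi\times\mathbb Z$ by $\varpi^\lambda w(\beta,n)=(w\beta,n+\langle\lambda,w\beta\rangle)$, and $(\beta,n)$ is positive if $n>0$, or $n=0$ and $\beta\in\Phi_+$. For $\beta\in\Phi_+$ and $n\in\mathbb Z$ let $\beta[n]=(\mathrm{sgn}(n)\beta,|n|)$ (with $\mathrm{sgn}(0)=1$) and $s_{\beta[n]}=\varpi^{n\beta^\vee}s_\beta$. The affine Bruhat order $<$ on $W^+$ is the transitive closure of the relations $s_{\beta[n]}\mathbf x<\mathbf x$, where $\mathbf x\in W^+$, $\beta\in\Phi_+$, $n\in\mathbb Z$ and $\mathbf x^{-1}(\beta[n])$ is not positive. An element $\mathbf y$ covers $\mathbf x$ if $\mathbf x<\mathbf y$ and there is no $\mathbf z$ with $\mathbf x<\mathbf z<\mathbf y$; then $\mathbf x$ is a co-cover of $\mathbf y$. Theorem. Every $\mathbf x\in W^+$ has finitely many covers for the affine Bruhat order.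 More precisely, the set $\mathcal Q(\Phi_+)$ of quantum roots is finite; every $u\in W^v$ has a finite number $n_{cov}(u)$ of covers and a finite number $n_{cocov}(u)$ of co-covers for the Bruhat order of $W^v$; $\mathbf x$ can be written $\mathbf x=\varpi^{v\lambda}w$ with $\lambda\in Y^{++}$, $v,w\in W^v$ and $v$ of minimal length among the $u\in W^v$ with $u\lambda=v\lambda$; and for every such expression $\mathbf x$ has at most $$2\,\#\mathcal Q(\Phi_+)+n_{cov}(v^{-1}w)+n_{cocov}(v)$$ covers. -/

import Mathlib

/-- A generalized Cartan matrix indexed by `I`. -/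
structure IsGeneralizedCartanMatrix {I : Type*} (A : Matrix I I ℤ) : Prop where
  diag : ∀ i, A i i = 2
  nonpos : ∀ i j, i ≠ j → A i j ≤ 0
  symm_zero : ∀ i j, A i j = 0 → A j i = 0

/-- A Kac-Moody root datum `(A, X, Y, (α_i), (α_i^∨))`, with finite index set `I`: the modules `X`
and `Y` are free `ℤ`-modules of finite rank in perfect duality, the simple roots and the simple
coroots are linearly independent, and `⟨α_i^∨, α_j⟩ = A i j`. -/
structure KacMoodyRootDatum (I X Y : Type*) [Finite I]
    [AddCommGroup X] [Module.Free ℤ X] [Module.Finite ℤ X]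
    [AddCommGroup Y] [Module.Free ℤ Y] [Module.Finite ℤ Y] where
  A : Matrix I I ℤ
  isGCM : IsGeneralizedCartanMatrix A
  pairing : Y →ₗ[ℤ] X →ₗ[ℤ] ℤ
  isPerfPair : pairing.IsPerfPair
  simpleRoot : I → X
  simpleCoroot : I → Y
  linearIndependent_simpleRoot : LinearIndependent ℤ simpleRoot
  linearIndependent_simpleCoroot : LinearIndependent ℤ simpleCoroot
  pairing_simple : ∀ i j, pairing (simpleCoroot i) (simpleRoot j) = A i j

/-- The set of all `y` that cover `x`, for a strict order `lt`. -/
def coversOf {α : Type*} (lt : α → α → Prop) (x : α) : Set α :=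
  {y | lt x y ∧ ∀ z, ¬ (lt x z ∧ lt z y)}

/-- The set of all `x` that are covered by `y` (the co-covers of `y`), for a strict order `lt`. -/
def cocoversOf {α : Type*} (lt : α → α → Prop) (y : α) : Set α :=
  {x | y ∈ coversOf lt x}

namespace KacMoodyRootDatum

noncomputable section

variable {I X Y : Type*} [Finite I]
  [AddCommGroup X] [Module.Free ℤ X] [Module.Finite ℤ X]
  [AddCommGroup Y] [Module.Free ℤ Y] [Module.Finite ℤ Y]
  (D : KacMoodyRootDatum I X Y)

instance : D.pairing.IsPerfPair := D.isPerfPair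

/-! ### The vectorial Weyl group -/

/-- The simple reflection `r_i : x ↦ x - ⟨α_i^∨, x⟩ α_i` of `X`. -/
def simpleReflection (i : I) : X ≃ₗ[ℤ] X :=
  Module.reflection (x := D.simpleRoot i) (f := D.pairing (D.simpleCoroot i))
    ((D.pairing_simple i i).trans (D.isGCM.diag i))

theorem simpleReflection_apply (i : I) (x : X) :
    D.simpleReflection i x = x - D.pairing (D.simpleCoroot i) x • D.simpleRoot i := by
  simp [simpleReflection, Module.reflection_apply]

/-- The vectorial Weyl group `W^v`, generated by the simple reflections of `X`. -/
def weylGroup : Subgroup (X ≃ₗ[ℤ] X) :=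
  Subgroup.closure (Set.range D.simpleReflection)

/-- The simple reflection `r_i` as an element of `W^v`. -/
def r (i : I) : D.weylGroup :=
  ⟨D.simpleReflection i, Subgroup.subset_closure ⟨i, rfl⟩⟩

/-- The contragredient of an automorphism `g` of `X`: the automorphism of `Y` characterized by
`⟨g y, x⟩ = ⟨y, g⁻¹ x⟩`. -/
def contragredient (g : X ≃ₗ[ℤ] X) : Y ≃ₗ[ℤ] Y :=
  (D.pairing.toPerfPair.trans g.symm.dualMap).trans D.pairing.toPerfPair.symm

theorem pairing_contragredient (g : X ≃ₗ[ℤ] X) (y : Y) (x : X) :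
    D.pairing (D.contragredient g y) x = D.pairing y (g.symm x) := by
  simp [contragredient]

theorem eq_of_pairing_eq {y y' : Y} (h : ∀ x, D.pairing y x = D.pairing y' x) : y = y' :=
  (LinearMap.IsPerfPair.bijective_left D.pairing).1 (LinearMap.ext h)

/-- The contragredient action of `W^v` on `Y`. -/
def actY : D.weylGroup →* MulAut (Multiplicative Y) where
  toFun w := (D.contragredient (w : X ≃ₗ[ℤ] X)).toAddEquiv.toMultiplicative
  map_one' := by
    ext y
    refine Multiplicative.toAdd.injective (D.eq_of_pairing_eq fun x => ?_)
    exact D.pairing_contragredient _ _ _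
  map_mul' v w := by
    ext y
    refine Multiplicative.toAdd.injective (D.eq_of_pairing_eq fun x => ?_)
    refine (D.pairing_contragredient _ _ _).trans ?_
    exact ((D.pairing_contragredient _ _ _).trans (D.pairing_contragredient _ _ _)).symm

/-- `w y`, for `w ∈ W^v` and `y ∈ Y`, written additively. -/
def smulY (w : D.weylGroup) (y : Y) : Y := (D.actY w (Multiplicative.ofAdd y)).toAdd

theorem pairing_smulY (w : D.weylGroup) (y : Y) (x : X) :
    D.pairing (D.smulY w y) ((w : X ≃ₗ[ℤ] X) x) = D.pairing y x :=
  (D.pairing_contragredient _ _ _).trans (by simp)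

theorem smulY_r (i : I) (y : Y) :
    D.smulY (D.r i) y = y - D.pairing y (D.simpleRoot i) • D.simpleCoroot i := by
  refine D.eq_of_pairing_eq fun x => (D.pairing_contragredient _ _ _).trans ?_
  have h : (D.r i : X ≃ₗ[ℤ] X).symm x = D.simpleReflection i x := rfl
  change D.pairing y ((D.r i : X ≃ₗ[ℤ] X).symm x) = _
  rw [h, simpleReflection_apply]
  simp [mul_comm]

/-- The length `ℓ(w)`: the least number of factors in an expression of `w` as a product of simple
reflections. -/
def length (w : D.weylGroup) : ℕ :=
  sInf {n | ∃ l : List I, l.length = n ∧ (l.map D.r).prod = w}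

/-! ### Real roots -/

/-- The set `Φ` of real roots. -/
def realRoots : Set X :=
  {β | ∃ (w : D.weylGroup) (i : I), β = (w : X ≃ₗ[ℤ] X) (D.simpleRoot i)}

/-- The set `Φ_+` of positive real roots. -/
def posRoots : Set X :=
  {β | β ∈ D.realRoots ∧ β ∈ AddSubmonoid.closure (Set.range D.simpleRoot)}

/-- The set `Φ_- = -Φ_+` of negative real roots. -/
def negRoots : Set X := {β | -β ∈ D.posRoots}

theorem realRoot_exists (β : D.realRoots) :
    ∃ p : D.weylGroup × I, (β : X) = (p.1 : X ≃ₗ[ℤ] X) (D.simpleRoot p.2) := by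
  obtain ⟨β, w, i, h⟩ := β
  exact ⟨(w, i), h⟩

/-- A pair `(w, i)` with `β = w α_i`; the coroot and the reflection of `β` below do not depend on
its choice. -/
def rep (β : D.realRoots) : D.weylGroup × I := (D.realRoot_exists β).choose

theorem rep_spec (β : D.realRoots) :
    (β : X) = ((D.rep β).1 : X ≃ₗ[ℤ] X) (D.simpleRoot (D.rep β).2) :=
  (D.realRoot_exists β).choose_spec

/-- The coroot `β^∨ = w α_i^∨` of the real root `β = w α_i`. -/
def coroot (β : D.realRoots) : Y :=
  D.smulY (D.rep β).1 (D.simpleCoroot (D.rep β).2)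

/-- The reflection `s_β = w r_i w⁻¹ ∈ W^v` of the real root `β = w α_i`. -/
def reflection (β : D.realRoots) : D.weylGroup :=
  (D.rep β).1 * D.r (D.rep β).2 * (D.rep β).1⁻¹

theorem reflection_apply (β : D.realRoots) (x : X) :
    (D.reflection β : X ≃ₗ[ℤ] X) x = x - D.pairing (D.coroot β) x • (β : X) := by
  have h := D.pairing_smulY (D.rep β).1 (D.simpleCoroot (D.rep β).2)
    (((D.rep β).1 : X ≃ₗ[ℤ] X).symm x)
  rw [LinearEquiv.apply_symm_apply] at h
  change ((D.rep β).1 : X ≃ₗ[ℤ] X)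
    (D.simpleReflection (D.rep β).2 (((D.rep β).1 : X ≃ₗ[ℤ] X).symm x)) = _
  rw [simpleReflection_apply, map_sub, LinearEquiv.apply_symm_apply, map_smul, ← D.rep_spec β,
    coroot, h]

/-- The inversion set `Inv(w) = {α ∈ Φ_+ | w α ∈ Φ_-}`. -/
def inv (w : D.weylGroup) : Set X :=
  {α | α ∈ D.posRoots ∧ (w : X ≃ₗ[ℤ] X) α ∈ D.negRoots}

/-- A positive real root `β` is quantum if `⟨β^∨, γ⟩ = 1` for all `γ ∈ Inv(s_β) \ {β}`. -/
def IsQuantum (β : D.realRoots) : Prop :=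
  (β : X) ∈ D.posRoots ∧
    ∀ γ ∈ D.inv (D.reflection β) \ {(β : X)}, D.pairing (D.coroot β) γ = 1

/-- The set of quantum roots. -/
def quantumRoots : Set D.realRoots := {β | D.IsQuantum β}

/-- The (strict) Bruhat order on `W^v`: the transitive closure of the relation
`u < s_β u` whenever `ℓ(u) < ℓ(s_β u)`. -/
def bruhatLT : D.weylGroup → D.weylGroup → Prop :=
  Relation.TransGen fun u v =>
    ∃ β : D.realRoots, v = D.reflection β * u ∧ D.length u < D.length v

/-! ### The affine Weyl semigroup -/

/-- The set `Y^{++}` of dominant coweights. -/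
def dominant : Set Y := {y | ∀ i, 0 ≤ D.pairing y (D.simpleRoot i)}

/-- The integral Tits cone `Y^+`. -/
def titsCone : Set Y := {y | ∃ w : D.weylGroup, ∃ y₀ ∈ D.dominant, y = D.smulY w y₀}

/-- The semidirect product `Y ⋊ W^v`. -/
abbrev ExtAffineWeylGroup : Type _ := Multiplicative Y ⋊[D.actY] D.weylGroup

/-- The element `ϖ^y w` of `Y ⋊ W^v`. -/
def ofPair (y : Y) (w : D.weylGroup) : D.ExtAffineWeylGroup := ⟨Multiplicative.ofAdd y, w⟩

/-- The affine Weyl semigroup `W^+ = Y^+ ⋊ W^v`, as a subset of `Y ⋊ W^v`. -/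
def affineWeyl : Set D.ExtAffineWeylGroup := {x | x.left.toAdd ∈ D.titsCone}

/-- The action of `Y ⋊ W^v` on `X × ℤ`, hence on the set `Φ × ℤ` of affine roots:
`ϖ^y w (β, n) = (w β, n + ⟨y, w β⟩)`. -/
def affineAct (x : D.ExtAffineWeylGroup) (a : X × ℤ) : X × ℤ :=
  ((x.right : X ≃ₗ[ℤ] X) a.1,
    a.2 + D.pairing x.left.toAdd ((x.right : X ≃ₗ[ℤ] X) a.1))

/-- The set of positive affine roots: the `(β, n) ∈ Φ × ℤ` with `n > 0`, or `n = 0` and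
`β ∈ Φ_+`. -/
def posAffineRoots : Set (X × ℤ) :=
  {a | a.1 ∈ D.realRoots ∧ (0 < a.2 ∨ (a.2 = 0 ∧ a.1 ∈ D.posRoots))}

/-- The positive affine root `β[n] = (sgn(n) β, |n|)`, for `β ∈ Φ_+` and `n ∈ ℤ`, where
`sgn(0) = 1`. -/
def affineRoot (β : D.realRoots) (n : ℤ) : X × ℤ :=
  (if 0 ≤ n then (β : X) else -(β : X), |n|)

/-- The affine reflection `s_{β[n]} = ϖ^{n β^∨} s_β`. -/
def affineReflection (β : D.realRoots) (n : ℤ) : D.ExtAffineWeylGroup :=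
  D.ofPair (n • D.coroot β) (D.reflection β)

/-- The relation generating the affine Bruhat order on `W^+`: for `x ∈ W^+`, `β ∈ Φ_+` and
`n ∈ ℤ`, one has `s_{β[n]} x < x` if and only if `x⁻¹ (β[n])` is not a positive affine root. -/
def affineStep (y x : D.affineWeyl) : Prop :=
  ∃ β : D.realRoots, (β : X) ∈ D.posRoots ∧ ∃ n : ℤ,
    (y : D.ExtAffineWeylGroup) = D.affineReflection β n * x ∧
      D.affineAct (x : D.ExtAffineWeylGroup)⁻¹ (D.affineRoot β n) ∉ D.posAffineRoots

/-- The (strict) affine Bruhat order on `W^+`. -/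
def affineBruhatLT : D.affineWeyl → D.affineWeyl → Prop := Relation.TransGen D.affineStep

/-- `v` has minimal length among all `u ∈ W^v` with `u y = v y`, that is, in the coset
`v W_y` of the fixator `W_y` of `y`. -/
def IsMinimalFor (y : Y) (v : D.weylGroup) : Prop :=
  ∀ u : D.weylGroup, D.smulY u y = D.smulY v y → D.length v ≤ D.length u

/-- `x = ϖ^{v y} w` with `y` dominant and `v` of minimal length. -/
def IsDecomposition (x : D.ExtAffineWeylGroup) (y : Y) (v w : D.weylGroup) : Prop :=
  y ∈ D.dominant ∧ D.IsMinimalFor y v ∧ x = D.ofPair (D.smulY v y) w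

end

end KacMoodyRootDatum

namespace KacMoodyRootDatum

variable {I X Y : Type*} [Finite I]
  [AddCommGroup X] [Module.Free ℤ X] [Module.Finite ℤ X]
  [AddCommGroup Y] [Module.Free ℤ Y] [Module.Finite ℤ Y]
  (D : KacMoodyRootDatum I X Y)

/-! ### Coordinates and the positive cone -/

/-! A cover of `x` is a single reflection `s_a x`, for a positive affine root `a` with `x⁻¹ a`
positive. Most such `a` do not give covers, because of a criterion for intermediate elements
(`exists_between`): it suffices to find an affine root `b`, with `2b ≠ ⟨a^∨, b⟩ a`, such that `b`
and `-s_a b` are positive and remain so under `x⁻¹`. If `s_b a` is positive, then `x < s_b x < s_b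
s_a x < s_a x`; if `x⁻¹ s_b a` is positive, then `x < s_b x < s_a s_b x < s_a x`. The admissible `b`
form a finite set (`finite_pairs`). If none of them had one of these two properties, `b ↦ -s_b a`
would preserve this set while expanding the component transverse to `a`, which is impossible
(`exists_refl_pos`).

Write `x = ϖ^{vλ} v u` and `a = (vγ, n)`. For `γ > 0`, positivity forces `n ≥ ⟨λ, γ⟩`; for `γ < 0`
it forces `n ≥ 0`. At the least value of `n`, the step comes from a Bruhat cover of `u`,
respectively a co-cover of `v`. One unit above, the criterion forces `±γ` to be quantum: a root `η`
violating quantumness has `⟨γ^∨, η⟩ ≥ 2`, and this excess keeps both `b` and `-s_a b` positive.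
Higher still, `b = (vγ, n - 1)` interposes an element. These four families (`cover_cases_pos`,
`cover_cases_neg`) give the bound.

The families are finite. A quantum coroot takes values at most 2 on simple roots, and two quantum
coroots are never comparable on the positive cone, so Dickson's lemma applies
(`finite_quantumRoots`). In `W^v` a cover raises the length by at most one, by the same criterion
with trivial translation. Underneath lie the positive/negative dichotomy for real roots and the
equality of length with the number of inversions, both derived from the generators. -/

/-- The monoid generated by the simple roots. -/
abbrev posCone : AddSubmonoid X := AddSubmonoid.closure (Set.range D.simpleRoot)

/-- The root lattice. -/
abbrev rootLattice : Submodule ℤ X := Submodule.span ℤ (Set.range D.simpleRoot)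

/-- The root lattice need not be a direct summand of `X`, so integral coordinates may not extend to
`X`; rational ones do. -/
theorem exists_coeff :
    ∃ f : X →ₗ[ℤ] (I →₀ ℚ), ∀ i, f (D.simpleRoot i) = Finsupp.single i 1 := by
  let b := Module.Free.chooseBasis ℤ X
  let e : X →ₗ[ℤ] (Module.Free.ChooseBasisIndex ℤ X →₀ ℚ) :=
    (Finsupp.mapRange.linearMap (Algebra.linearMap ℤ ℚ)) ∘ₗ b.repr.toLinearMap
  have he : Function.Injective e := by
    refine Function.Injective.comp (g := Finsupp.mapRange (Int.cast : ℤ → ℚ) Int.cast_zero) ?_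
      b.repr.injective
    exact Finsupp.mapRange_injective _ _ Int.cast_injective
  have h1 : LinearIndependent ℤ (e ∘ D.simpleRoot) :=
    D.linearIndependent_simpleRoot.map' e (LinearMap.ker_eq_bot.2 he)
  have h2 : LinearIndependent ℚ (e ∘ D.simpleRoot) :=
    (LinearIndependent.iff_fractionRing ℤ ℚ).1 h1
  obtain ⟨g, hg⟩ := LinearMap.exists_leftInverse_of_injective
    (Finsupp.linearCombination ℚ (e ∘ D.simpleRoot))
    (LinearMap.ker_eq_bot.2 h2.finsuppLinearCombination_injective)
  refine ⟨(g.restrictScalars ℤ) ∘ₗ e, fun i => ?_⟩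
  have := LinearMap.congr_fun hg (Finsupp.single i 1)
  simpa using this

/-- Linear functionals on `X` extending the coordinates with respect to the simple roots. -/
noncomputable def coeff : X →ₗ[ℤ] (I →₀ ℚ) := D.exists_coeff.choose

@[simp] theorem coeff_simpleRoot (i : I) : D.coeff (D.simpleRoot i) = Finsupp.single i 1 :=
  D.exists_coeff.choose_spec i

theorem coeff_nonneg {x : X} (hx : x ∈ D.posCone) (i : I) : 0 ≤ D.coeff x i := by
  classical
  induction hx using AddSubmonoid.closure_induction with
  | mem x h =>
    obtain ⟨j, rfl⟩ := h
    rw [coeff_simpleRoot, Finsupp.single_apply]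
    split_ifs <;> norm_num
  | zero => simp
  | add x y _ _ h1 h2 => simpa using add_nonneg h1 h2

theorem coeff_int {x : X} (hx : x ∈ D.rootLattice) (i : I) : ∃ n : ℤ, D.coeff x i = n := by
  classical
  induction hx using Submodule.span_induction with
  | mem x h =>
    obtain ⟨j, rfl⟩ := h
    rw [coeff_simpleRoot, Finsupp.single_apply]
    split_ifs
    · exact ⟨1, by simp⟩
    · exact ⟨0, by simp⟩
  | zero => exact ⟨0, by simp⟩
  | add x y _ _ h1 h2 =>
    obtain ⟨m, hm⟩ := h1
    obtain ⟨n, hn⟩ := h2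
    exact ⟨m + n, by simp [hm, hn]⟩
  | smul a x _ h =>
    obtain ⟨n, hn⟩ := h
    exact ⟨a * n, by simp [hn]⟩

theorem eq_zero_of_coeff {x : X} (hx : x ∈ D.rootLattice) (h : D.coeff x = 0) : x = 0 := by
  obtain ⟨c, rfl⟩ := Finsupp.mem_span_range_iff_exists_finsupp.1 hx
  have : c = 0 := by
    ext i
    have h' := DFunLike.congr_fun h i
    classical
    rw [Finsupp.sum, map_sum, Finsupp.finsetSum_apply] at h'
    simp only [map_smul, coeff_simpleRoot, Finsupp.smul_apply, Finsupp.single_apply] at h'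
    rw [Finset.sum_eq_single i] at h'
    · simpa using h'
    · intro j _ hj
      simp [hj]
    · intro hi
      simp [Finsupp.notMem_support_iff.1 hi]
  simp [this]

theorem posCone_le {x : X} (hx : x ∈ D.posCone) : x ∈ D.rootLattice :=
  AddSubmonoid.closure_le (S := D.rootLattice.toAddSubmonoid).2 Submodule.subset_span hx

theorem simpleRoot_mem_posCone (i : I) : D.simpleRoot i ∈ D.posCone :=
  AddSubmonoid.subset_closure ⟨i, rfl⟩

theorem posCone_antisymm {x : X} (hx : x ∈ D.posCone) (hx' : -x ∈ D.posCone) : x = 0 := by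
  refine D.eq_zero_of_coeff (D.posCone_le hx) (Finsupp.ext fun i => ?_)
  have h1 := D.coeff_nonneg hx i
  have h2 := D.coeff_nonneg hx' i
  simp only [map_neg, Finsupp.coe_neg, Pi.neg_apply] at h2
  exact le_antisymm (neg_nonneg.1 h2) h1

theorem simpleRoot_ne_zero (i : I) : D.simpleRoot i ≠ 0 := D.linearIndependent_simpleRoot.ne_zero i

/-! ### Words and length -/

theorem r_smul (i : I) (x : X) :
    D.r i • x = x - D.pairing (D.simpleCoroot i) x • D.simpleRoot i :=
  D.simpleReflection_apply i x

theorem ext_smul {v w : D.weylGroup} (h : ∀ x : X, v • x = w • x) : v = w :=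
  Subtype.ext (LinearEquiv.ext h)

@[simp] theorem r_mul_r (i : I) : D.r i * D.r i = 1 := by
  refine D.ext_smul fun x => ?_
  rw [mul_smul, one_smul, r_smul, r_smul]
  simp only [map_sub, map_smul, D.pairing_simple, D.isGCM.diag, smul_eq_mul]
  module

@[simp] theorem r_inv (i : I) : (D.r i)⁻¹ = D.r i := inv_eq_of_mul_eq_one_right (D.r_mul_r i)

theorem r_smul_self (i : I) : D.r i • D.simpleRoot i = -D.simpleRoot i := by
  rw [r_smul, D.pairing_simple, D.isGCM.diag]
  module

theorem exists_word (w : D.weylGroup) : ∃ l : List I, (l.map D.r).prod = w := by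
  have key : ∀ x (hx : x ∈ Subgroup.closure (Set.range D.simpleReflection)),
      ∃ l : List I, (l.map D.r).prod = (⟨x, hx⟩ : D.weylGroup) := by
    intro x hx
    induction hx using Subgroup.closure_induction with
    | mem x h =>
      obtain ⟨i, rfl⟩ := h
      exact ⟨[i], by simp [r]⟩
    | one => exact ⟨[], rfl⟩
    | mul x y hx hy h1 h2 =>
      obtain ⟨l, hl⟩ := h1
      obtain ⟨m, hm⟩ := h2
      exact ⟨l ++ m, by rw [List.map_append, List.prod_append, hl, hm]; rfl⟩
    | inv x hx h1 =>
      obtain ⟨l, hl⟩ := h1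
      refine ⟨l.reverse, ?_⟩
      have h : ∀ l : List I, (l.reverse.map D.r).prod = ((l.map D.r).prod)⁻¹ := by
        intro l
        induction l with
        | nil => simp
        | cons a l ih => simp [ih, -List.map_reverse]
      rw [h, hl]
      rfl
  exact key w.1 w.2

theorem length_le (l : List I) : D.length (l.map D.r).prod ≤ l.length :=
  Nat.sInf_le ⟨l, rfl, rfl⟩

theorem exists_reduced (w : D.weylGroup) :
    ∃ l : List I, l.length = D.length w ∧ (l.map D.r).prod = w := by
  obtain ⟨l, hl⟩ := D.exists_word w
  exact Nat.sInf_mem (s := {n | ∃ l : List I, l.length = n ∧ (l.map D.r).prod = w})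
    ⟨_, l, rfl, hl⟩

theorem length_one : D.length 1 = 0 := Nat.le_zero.1 (D.length_le [])

theorem eq_one_of_length {w : D.weylGroup} (h : D.length w = 0) : w = 1 := by
  obtain ⟨l, hl, rfl⟩ := D.exists_reduced w
  rw [h, List.length_eq_zero_iff] at hl
  simp [hl]

theorem length_mul_prod (w : D.weylGroup) (l : List I) :
    D.length (w * (l.map D.r).prod) ≤ D.length w + l.length := by
  obtain ⟨m, hm, rfl⟩ := D.exists_reduced w
  rw [← List.prod_append, ← List.map_append, ← hm, ← List.length_append]
  exact D.length_le _

theorem length_mul_r (w : D.weylGroup) (i : I) : D.length (w * D.r i) ≤ D.length w + 1 := by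
  simpa using D.length_mul_prod w [i]

theorem length_le_mul_r (w : D.weylGroup) (i : I) : D.length w ≤ D.length (w * D.r i) + 1 := by
  simpa [mul_assoc] using D.length_mul_r (w * D.r i) i

theorem exists_length_mul_r {w : D.weylGroup} (h : w ≠ 1) :
    ∃ i, D.length (w * D.r i) + 1 = D.length w := by
  obtain ⟨l, hl, hw⟩ := D.exists_reduced w
  rcases List.eq_nil_or_concat l with rfl | ⟨m, i, rfl⟩
  · exact absurd (by simpa using hw.symm) h
  · refine ⟨i, le_antisymm ?_ (D.length_le_mul_r w i)⟩
    have h1 : w * D.r i = (m.map D.r).prod := by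
      rw [← hw]
      simp [mul_assoc]
    rw [h1, ← hl]
    simpa using D.length_le m

/-! ### Positivity of roots -/

/-- The alternating product of length `k` in two simple reflections, ending in `r t`. -/
noncomputable def alt (t s : I) : ℕ → D.weylGroup
  | 0 => 1
  | k + 1 => alt s t k * D.r t

theorem alt_succ' (t s : I) (k : ℕ) :
    D.alt t s (k + 1) = D.r (if Even k then t else s) * D.alt t s k := by
  induction k generalizing t s with
  | zero => simp [alt]
  | succ k ih =>
    rw [alt, ih s t, mul_assoc, ← alt]
    simp only [Nat.even_add_one]
    split_ifs <;> simp_all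

theorem exists_alt_word (t s : I) (k : ℕ) :
    ∃ l : List I, l.length = k ∧ (l.map D.r).prod = D.alt t s k := by
  induction k generalizing t s with
  | zero => exact ⟨[], rfl, rfl⟩
  | succ k ih =>
    obtain ⟨l, hl, h⟩ := ih s t
    exact ⟨l ++ [t], by simp [hl], by simp [alt, h]⟩

theorem alt_add (t s : I) (k m : ℕ) :
    ∃ l : List I, l.length = k ∧ D.alt t s (k + m) = (l.map D.r).prod * D.alt t s m := by
  induction k with
  | zero => exact ⟨[], rfl, by simp⟩
  | succ k ih =>
    obtain ⟨l, hl, h⟩ := ih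
    refine ⟨(if Even (k + m) then t else s) :: l, by simp [hl], ?_⟩
    rw [show k + 1 + m = (k + m) + 1 by ring, alt_succ', h]
    simp [mul_assoc]

/-- Coordinates of `alt t s k • α_s` where `a = -⟨α_s^∨, α_t⟩` and `b = -⟨α_t^∨, α_s⟩`. -/
def altCoeff (a b : ℤ) : ℕ → ℤ × ℤ
  | 0 => (1, 0)
  | k + 1 => if Even k then ((altCoeff a b k).1, b * (altCoeff a b k).1 - (altCoeff a b k).2)
      else (a * (altCoeff a b k).2 - (altCoeff a b k).1, (altCoeff a b k).2)

theorem alt_smul (t s : I) (k : ℕ) :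
    D.alt t s k • D.simpleRoot s =
      (altCoeff (-D.A s t) (-D.A t s) k).1 • D.simpleRoot s +
        (altCoeff (-D.A s t) (-D.A t s) k).2 • D.simpleRoot t := by
  induction k with
  | zero => simp [alt, altCoeff]
  | succ k ih =>
    rw [alt_succ', mul_smul, ih, altCoeff]
    split_ifs with h <;>
    · rw [r_smul]
      simp only [map_add, map_smul, D.pairing_simple, D.isGCM.diag, smul_eq_mul]
      module

/-- The infinite dihedral case. The third conjunct is the invariant that makes the induction close:
the coordinate about to be changed does not decrease, because `a * b ≥ 4`. -/
theorem altCoeff_nonneg {a b : ℤ} (ha : 0 ≤ a) (hb : 0 ≤ b) (hab : 4 ≤ a * b) (k : ℕ) :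
    0 ≤ (altCoeff a b k).1 ∧ 0 ≤ (altCoeff a b k).2 ∧
      (if Even k then a * (altCoeff a b k).2 ≤ 2 * (altCoeff a b k).1
        else b * (altCoeff a b k).1 ≤ 2 * (altCoeff a b k).2) := by
  induction k with
  | zero => simp [altCoeff]
  | succ k ih =>
    obtain ⟨h1, h2, h3⟩ := ih
    simp only [altCoeff, Nat.even_add_one]
    set p := (altCoeff a b k).1
    set q := (altCoeff a b k).2
    split_ifs at h3 ⊢ with h
    · have : 4 * p ≤ a * b * p := mul_le_mul_of_nonneg_right hab h1
      have h4 : 2 * q ≤ b * p := by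
        by_contra! hlt
        nlinarith [mul_le_mul_of_nonneg_left h3 hb]
      exact ⟨h1, by nlinarith, by nlinarith⟩
    · have h4 : 2 * p ≤ a * q := by
        by_contra! hlt
        nlinarith [mul_le_mul_of_nonneg_left h3 ha, mul_le_mul_of_nonneg_right hab h2]
      exact ⟨by nlinarith, h2, by nlinarith⟩

/-- Braid relations of the finite rank-two types. Both words only change `x` by a combination of the
two simple roots, so following its two coefficients decides the equality. -/
theorem alt_braid {s t : I} {m : ℕ}
    (h : (D.A s t = 0 ∧ D.A t s = 0 ∧ m = 2) ∨ (D.A s t = -1 ∧ D.A t s = -1 ∧ m = 3) ∨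
      (D.A s t = -1 ∧ D.A t s = -2 ∧ m = 4) ∨ (D.A s t = -2 ∧ D.A t s = -1 ∧ m = 4) ∨
      (D.A s t = -1 ∧ D.A t s = -3 ∧ m = 6) ∨ (D.A s t = -3 ∧ D.A t s = -1 ∧ m = 6)) :
    D.alt t s m = D.alt s t m := by
  have hs : ∀ (x : X) (p q : ℤ), D.r s • (x - p • D.simpleRoot s - q • D.simpleRoot t) =
      x - (D.pairing (D.simpleCoroot s) x - p - D.A s t * q) • D.simpleRoot s -
        q • D.simpleRoot t := by
    intro x p q
    rw [r_smul]
    simp only [map_sub, map_smul, D.pairing_simple, D.isGCM.diag, smul_eq_mul]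
    module
  have ht : ∀ (x : X) (p q : ℤ), D.r t • (x - p • D.simpleRoot s - q • D.simpleRoot t) =
      x - p • D.simpleRoot s -
        (D.pairing (D.simpleCoroot t) x - D.A t s * p - q) • D.simpleRoot t := by
    intro x p q
    rw [r_smul]
    simp only [map_sub, map_smul, D.pairing_simple, D.isGCM.diag, smul_eq_mul]
    module
  refine D.ext_smul fun x => ?_
  have hx : x = x - (0 : ℤ) • D.simpleRoot s - (0 : ℤ) • D.simpleRoot t := by simp
  rcases h with ⟨h1, h2, rfl⟩ | ⟨h1, h2, rfl⟩ | ⟨h1, h2, rfl⟩ | ⟨h1, h2, rfl⟩ | ⟨h1, h2, rfl⟩ |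
    ⟨h1, h2, rfl⟩ <;>
  · rw [hx]
    simp only [alt, mul_smul, one_smul, hs, ht, h1, h2]
    module

/-- In finite type a braid relation bounds `k`, leaving finitely many explicit coefficients to
inspect; otherwise `altCoeff_nonneg` applies. -/
theorem alt_smul_mem {s t : I} (hst : s ≠ t) {k : ℕ}
    (hk : ∀ m ≤ k, 0 < m → D.alt t s m ≠ D.alt s t m) :
    0 ≤ (altCoeff (-D.A s t) (-D.A t s) k).1 ∧ 0 ≤ (altCoeff (-D.A s t) (-D.A t s) k).2 := by
  have ha := D.isGCM.nonpos s t hst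
  have hb := D.isGCM.nonpos t s hst.symm
  by_cases hab : 4 ≤ -D.A s t * -D.A t s
  · have h := altCoeff_nonneg (neg_nonneg.2 ha) (neg_nonneg.2 hb) hab k
    exact ⟨h.1, h.2.1⟩
  have hlt : ∀ m, 0 < m → D.alt t s m = D.alt s t m → k < m := fun m h0 hm => by
    by_contra! h
    exact hk m h h0 hm
  have hz := D.isGCM.symm_zero s t
  have hz' := D.isGCM.symm_zero t s
  obtain ⟨a, ha'⟩ : ∃ a, a = -D.A s t := ⟨_, rfl⟩
  obtain ⟨b, hb'⟩ : ∃ b, b = -D.A t s := ⟨_, rfl⟩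
  have hA : D.A s t = -a := by omega
  have hB : D.A t s = -b := by omega
  rw [← ha', ← hb'] at hab ⊢
  have ha0 : 0 ≤ a := by omega
  have hb0 : 0 ≤ b := by omega
  have hcases : (a = 0 ∧ b = 0) ∨ (a = 1 ∧ b = 1) ∨ (a = 1 ∧ b = 2) ∨ (a = 2 ∧ b = 1) ∨
      (a = 1 ∧ b = 3) ∨ (a = 3 ∧ b = 1) := by
    rcases eq_or_lt_of_le ha0 with h | h
    · exact Or.inl ⟨h.symm, by have := hz (by omega); omega⟩
    rcases eq_or_lt_of_le hb0 with h' | h'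
    · exact Or.inl ⟨by have := hz' (by omega); omega, h'.symm⟩
    have : a ≤ 3 := by nlinarith
    have : b ≤ 3 := by nlinarith
    interval_cases a <;> interval_cases b <;> omega
  rcases hcases with ⟨rfl, rfl⟩ | ⟨rfl, rfl⟩ | ⟨rfl, rfl⟩ | ⟨rfl, rfl⟩ | ⟨rfl, rfl⟩ | ⟨rfl, rfl⟩
  · have := hlt 2 (by norm_num) (D.alt_braid (by simp [hA, hB]))
    interval_cases k <;> decide
  · have := hlt 3 (by norm_num) (D.alt_braid (by simp [hA, hB]))
    interval_cases k <;> decide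
  · have := hlt 4 (by norm_num) (D.alt_braid (by simp [hA, hB]))
    interval_cases k <;> decide
  · have := hlt 4 (by norm_num) (D.alt_braid (by simp [hA, hB]))
    interval_cases k <;> decide
  · have := hlt 6 (by norm_num) (D.alt_braid (by simp [hA, hB]))
    interval_cases k <;> decide
  · have := hlt 6 (by norm_num) (D.alt_braid (by simp [hA, hB]))
    interval_cases k <;> decide

/-- Reduction to rank two: `w` factors with additive lengths as `v` times an alternating word in `s`
and `t`, where neither `s` nor `t` is a descent of `v`. The alternating word sends `α_s` to a
nonnegative combination of `α_s` and `α_t`, and induction on length handles `v • α_s` and `v • α_t`.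
-/
theorem smul_simpleRoot_mem_posCone {w : D.weylGroup} {s : I}
    (h : D.length w ≤ D.length (w * D.r s)) : w • D.simpleRoot s ∈ D.posCone := by
  induction hn : D.length w using Nat.strong_induction_on generalizing w s with
  | _ n ih =>
  subst hn
  by_cases hw : w = 1
  · rw [hw, one_smul]
    exact D.simpleRoot_mem_posCone s
  obtain ⟨t, ht⟩ := D.exists_length_mul_r hw
  have hst : s ≠ t := by
    rintro rfl
    omega
  -- `P k`: an alternating suffix of length `k`, ending in `t`, can be stripped from `w` with full
  -- drop in length. The greatest such `k` is used.
  let P : ℕ → Prop := fun k => D.length (w * (D.alt t s k)⁻¹) + k = D.length w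
  have hP1 : P 1 := by simpa [P, alt] using ht
  have hPle : ∀ k, P k → k ≤ D.length w := fun k hk => by
    simp only [P] at hk
    omega
  classical
  obtain ⟨k, hk1, hPk, hPk1⟩ : ∃ k, 1 ≤ k ∧ P k ∧ ¬ P (k + 1) := by
    refine ⟨Nat.findGreatest P (D.length w), Nat.le_findGreatest (hPle 1 hP1) hP1,
      Nat.findGreatest_spec (hPle 1 hP1) hP1, fun h => ?_⟩
    have := Nat.le_findGreatest (hPle _ h) h
    omega
  set v := w * (D.alt t s k)⁻¹ with hv
  have hwv : w = v * D.alt t s k := by rw [hv, inv_mul_cancel_right]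
  have hlen : D.length v + k = D.length w := hPk
  have hz : ∀ i, i = s ∨ i = t → D.length v ≤ D.length (v * D.r i) := by
    have h1 : D.length v ≤ D.length (v * D.r (if Even k then t else s)) := by
      have : v * D.r (if Even k then t else s) = w * (D.alt t s (k + 1))⁻¹ := by
        rw [alt_succ', mul_inv_rev, r_inv, ← mul_assoc]
      by_contra! hlt
      refine hPk1 ?_
      have h2 := D.length_le_mul_r v (if Even k then t else s)
      simp only [P]
      rw [← this]
      omega
    -- The other letter is the one stripped last; putting it back increases the length.
    have h2 : D.length v ≤ D.length (v * D.r (if Even k then s else t)) := by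
      obtain ⟨j, rfl⟩ : ∃ j, k = j + 1 := ⟨k - 1, by omega⟩
      have h3 : v * D.r (if Even (j + 1) then s else t) = w * (D.alt t s j)⁻¹ := by
        rw [hv, alt_succ', mul_inv_rev, r_inv, ← mul_assoc, mul_assoc]
        have h5 : (if Even (j + 1) then s else t) = if Even j then t else s := by
          by_cases h : Even j <;> simp [h, Nat.even_add_one]
        rw [h5, r_mul_r, mul_one]
      obtain ⟨l, hl, hl'⟩ := D.exists_alt_word t s j
      have h4 := D.length_mul_prod (w * (D.alt t s j)⁻¹) l
      rw [hl', inv_mul_cancel_right] at h4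
      rw [h3]
      omega
    rintro i (rfl | rfl)
    · split_ifs at h1 h2 <;> assumption
    · split_ifs at h1 h2 <;> assumption
  have hvs := ih (D.length v) (by omega) (hz s (Or.inl rfl)) rfl
  have hvt := ih (D.length v) (by omega) (hz t (Or.inr rfl)) rfl
  -- A braid relation would let the alternating word end in `s`, making `s` a descent of `w`,
  -- against the hypothesis.
  have hbraid : ∀ m ≤ k, 0 < m → D.alt t s m ≠ D.alt s t m := by
    intro m hm h0 heq
    obtain ⟨j, rfl⟩ : ∃ j, m = j + 1 := ⟨m - 1, by omega⟩
    obtain ⟨l, hl, hl'⟩ := D.alt_add t s (k - (j + 1)) (j + 1)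
    rw [Nat.sub_add_cancel hm, heq, alt] at hl'
    obtain ⟨l', hl1, hl2⟩ := D.exists_alt_word t s j
    have : w * D.r s = v * ((l ++ l').map D.r).prod := by
      rw [hwv, hl', List.map_append, List.prod_append, hl2]
      simp [mul_assoc]
    have h5 := D.length_mul_prod v (l ++ l')
    rw [← this, List.length_append] at h5
    omega
  obtain ⟨hp, hq⟩ := D.alt_smul_mem hst hbraid
  rw [hwv, mul_smul, alt_smul, smul_add, smul_comm v, smul_comm v]
  lift (altCoeff (-D.A s t) (-D.A t s) k).1 to ℕ using hp with p
  lift (altCoeff (-D.A s t) (-D.A t s) k).2 to ℕ using hq with q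
  rw [natCast_zsmul, natCast_zsmul]
  exact add_mem (nsmul_mem hvs _) (nsmul_mem hvt _)

/-! ### Real roots -/

theorem smul_mem_realRoots (w : D.weylGroup) {β : X} (h : β ∈ D.realRoots) :
    w • β ∈ D.realRoots := by
  obtain ⟨v, i, rfl⟩ := h
  exact ⟨w * v, i, rfl⟩

theorem neg_mem_realRoots {β : X} (h : β ∈ D.realRoots) : -β ∈ D.realRoots := by
  obtain ⟨v, i, rfl⟩ := h
  refine ⟨v * D.r i, i, ?_⟩
  change -(v • D.simpleRoot i) = (v * D.r i) • D.simpleRoot i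
  rw [mul_smul, r_smul_self, smul_neg]

theorem simpleRoot_mem_realRoots (i : I) : D.simpleRoot i ∈ D.realRoots := ⟨1, i, rfl⟩

theorem realRoot_ne_zero {β : X} (h : β ∈ D.realRoots) : β ≠ 0 := by
  obtain ⟨v, i, rfl⟩ := h
  exact (LinearEquiv.map_ne_zero_iff _).2 (D.simpleRoot_ne_zero i)

theorem pos_or_neg {β : X} (h : β ∈ D.realRoots) : β ∈ D.posRoots ∨ -β ∈ D.posRoots := by
  obtain ⟨v, i, hβ⟩ := id h
  change β = v • D.simpleRoot i at hβ
  rcases le_total (D.length v) (D.length (v * D.r i)) with hl | hl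
  · exact Or.inl ⟨h, hβ ▸ D.smul_simpleRoot_mem_posCone hl⟩
  · refine Or.inr ⟨D.neg_mem_realRoots h, ?_⟩
    have := D.smul_simpleRoot_mem_posCone (w := v * D.r i) (s := i) (by simpa [mul_assoc] using hl)
    rwa [mul_smul, r_smul_self, smul_neg, ← hβ] at this

theorem not_pos_and_neg {β : X} (h : β ∈ D.posRoots) (h' : -β ∈ D.posRoots) : False :=
  D.realRoot_ne_zero h.1 (D.posCone_antisymm h.2 h'.2)

theorem simpleRoot_mem_posRoots (i : I) : D.simpleRoot i ∈ D.posRoots :=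
  ⟨D.simpleRoot_mem_realRoots i, D.simpleRoot_mem_posCone i⟩

theorem smul_mem_rootLattice (w : D.weylGroup) {x : X} (hx : x ∈ D.rootLattice) :
    w • x ∈ D.rootLattice := by
  obtain ⟨l, rfl⟩ := D.exists_word w
  induction l with
  | nil => simpa using hx
  | cons i l ih =>
    rw [List.map_cons, List.prod_cons, mul_smul, r_smul]
    exact sub_mem ih (Submodule.smul_mem _ _ (Submodule.subset_span ⟨i, rfl⟩))

/-- A real root is not a proper multiple of an element of the root lattice. -/
theorem eq_one_or_of_eq_smul {β x : X} (h : β ∈ D.realRoots) (hx : x ∈ D.rootLattice) {n : ℤ}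
    (hn : β = n • x) : n = 1 ∨ n = -1 := by
  obtain ⟨v, i, rfl⟩ := h
  change v • D.simpleRoot i = n • x at hn
  have h1 : D.simpleRoot i = n • (v⁻¹ • x) := by
    rw [← smul_comm, ← hn, inv_smul_smul]
  obtain ⟨m, hm⟩ := D.coeff_int (D.smul_mem_rootLattice v⁻¹ hx) i
  have h2 := congrArg (fun y => D.coeff y i) h1
  simp only [coeff_simpleRoot, map_smul, Finsupp.smul_apply, hm, Finsupp.single_eq_same,
    zsmul_eq_mul] at h2
  exact Int.isUnit_iff.1 (IsUnit.of_mul_eq_one m (by exact_mod_cast h2.symm))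

theorem realRoot_mem_rootLattice {β : X} (h : β ∈ D.realRoots) : β ∈ D.rootLattice := by
  obtain ⟨v, i, rfl⟩ := h
  exact D.smul_mem_rootLattice v (Submodule.subset_span ⟨i, rfl⟩)

/-- By primitivity, `β` is not a multiple of `α_i`, so it has a positive coefficient at some `j ≠
i`; adding multiples of `α_i` leaves that coefficient unchanged. -/
theorem add_smul_simpleRoot_pos {β : X} {i : I} (hβ : β ∈ D.posRoots) (hne : β ≠ D.simpleRoot i)
    {n : ℤ} (h : β + n • D.simpleRoot i ∈ D.realRoots) :
    β + n • D.simpleRoot i ∈ D.posRoots := by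
  refine (D.pos_or_neg h).resolve_right fun hneg => hne ?_
  have h0 : ∀ j, j ≠ i → D.coeff β j = 0 := by
    intro j hj
    have h1 := D.coeff_nonneg hβ.2 j
    have h2 := D.coeff_nonneg hneg.2 j
    simp only [map_neg, map_add, map_smul, coeff_simpleRoot, Finsupp.coe_neg, Pi.neg_apply,
      Finsupp.coe_add, Pi.add_apply, Finsupp.smul_apply, Finsupp.single_eq_of_ne hj, smul_zero,
      add_zero] at h2
    exact le_antisymm (neg_nonneg.1 h2) h1
  obtain ⟨m, hm⟩ := D.coeff_int (D.posCone_le hβ.2) i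
  have hi : D.simpleRoot i ∈ D.rootLattice := Submodule.subset_span ⟨i, rfl⟩
  have h1 : β = m • D.simpleRoot i := by
    refine sub_eq_zero.1 (D.eq_zero_of_coeff (sub_mem (D.posCone_le hβ.2)
      (Submodule.smul_mem _ _ hi)) (Finsupp.ext fun j => ?_))
    by_cases hj : j = i
    · subst hj
      simp [hm]
    · simp [h0 j hj, Finsupp.single_eq_of_ne hj]
  rcases D.eq_one_or_of_eq_smul hβ.1 hi h1 with rfl | rfl
  · simpa using h1
  · exfalso
    have := D.coeff_nonneg hβ.2 i
    rw [hm] at this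
    norm_num at this

theorem r_smul_pos {β : X} {i : I} (hβ : β ∈ D.posRoots) (hne : β ≠ D.simpleRoot i) :
    D.r i • β ∈ D.posRoots := by
  have h := D.smul_mem_realRoots (D.r i) hβ.1
  rw [r_smul, sub_eq_add_neg, ← neg_smul] at h ⊢
  exact D.add_smul_simpleRoot_pos hβ hne h

/-! ### Inversion sets -/

theorem mem_inv {w : D.weylGroup} {β : X} :
    β ∈ D.inv w ↔ β ∈ D.posRoots ∧ -(w • β) ∈ D.posRoots := Iff.rfl

theorem inv_mul_r {w : D.weylGroup} {i : I} (h : w • D.simpleRoot i ∈ D.posRoots) :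
    D.inv (w * D.r i) = insert (D.simpleRoot i) ((D.r i • ·) '' D.inv w) := by
  ext β
  rw [Set.mem_insert_iff, mem_inv]
  constructor
  · rintro ⟨h1, h2⟩
    by_cases hβ : β = D.simpleRoot i
    · exact Or.inl hβ
    · refine Or.inr ⟨D.r i • β, ⟨D.r_smul_pos h1 hβ, ?_⟩, ?_⟩
      · rwa [mul_smul] at h2
      · simp [smul_smul]
  · rintro (rfl | ⟨γ, ⟨h1, h2⟩, rfl⟩)
    · refine ⟨D.simpleRoot_mem_posRoots i, ?_⟩
      rwa [mul_smul, r_smul_self, smul_neg, neg_neg]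
    · refine ⟨D.r_smul_pos h1 ?_, ?_⟩
      · rintro rfl
        exact D.not_pos_and_neg h h2
      · change -((w * D.r i) • D.r i • γ) ∈ _
        rwa [smul_smul, mul_assoc, r_mul_r, mul_one]

theorem inv_one : D.inv 1 = ∅ := by
  refine Set.eq_empty_of_forall_notMem fun β hβ => ?_
  rw [mem_inv, one_smul] at hβ
  exact D.not_pos_and_neg hβ.1 hβ.2

/-- Each letter of a reduced word contributes exactly one new inversion, by `inv_mul_r`. -/
theorem inv_finite_and_ncard (w : D.weylGroup) :
    (D.inv w).Finite ∧ (D.inv w).ncard = D.length w := by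
  induction hn : D.length w generalizing w with
  | zero =>
    rw [D.eq_one_of_length hn, inv_one]
    simp
  | succ n ih =>
    obtain ⟨i, hi⟩ := D.exists_length_mul_r (w := w) (by
      rintro rfl
      rw [length_one] at hn
      omega)
    obtain ⟨h1, h2⟩ := ih (w * D.r i) (by omega)
    have hw : w = w * D.r i * D.r i := by simp [mul_assoc]
    have hpos : (w * D.r i) • D.simpleRoot i ∈ D.posRoots :=
      ⟨D.smul_mem_realRoots _ (D.simpleRoot_mem_realRoots i),
        D.smul_simpleRoot_mem_posCone (by rw [← hw]; omega)⟩
    rw [hw, D.inv_mul_r hpos]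
    refine ⟨(h1.image _).insert _, ?_⟩
    rw [Set.ncard_insert_of_notMem _ (h1.image _),
      Set.ncard_image_of_injective _ (MulAction.injective _), h2]
    rintro ⟨γ, hγ, h⟩
    have : γ = -D.simpleRoot i := by
      rw [← r_smul_self, ← h, smul_smul, r_mul_r, one_smul]
    exact D.not_pos_and_neg hγ.1 (this ▸ by simpa using D.simpleRoot_mem_posRoots i)

theorem inv_finite (w : D.weylGroup) : (D.inv w).Finite := (D.inv_finite_and_ncard w).1

theorem ncard_inv (w : D.weylGroup) : (D.inv w).ncard = D.length w := (D.inv_finite_and_ncard w).2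

theorem eq_one_of_inv {w : D.weylGroup} (h : D.inv w = ∅) : w = 1 :=
  D.eq_one_of_length (by rw [← ncard_inv, h, Set.ncard_empty])

/-! ### Coroots and reflections -/

instance : SMul D.weylGroup D.realRoots :=
  ⟨fun w β => ⟨w • (β : X), D.smul_mem_realRoots w β.2⟩⟩

instance : Neg D.realRoots := ⟨fun β => ⟨-(β : X), D.neg_mem_realRoots β.2⟩⟩

@[simp] theorem coe_smul_root (w : D.weylGroup) (β : D.realRoots) :
    ((w • β : D.realRoots) : X) = w • (β : X) := rfl

@[simp] theorem coe_neg_root (β : D.realRoots) : ((-β : D.realRoots) : X) = -(β : X) := rfl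

theorem reflection_smul (β : D.realRoots) (x : X) :
    D.reflection β • x = x - D.pairing (D.coroot β) x • (β : X) := D.reflection_apply β x

theorem pairing_smulY_smul (w : D.weylGroup) (y : Y) (x : X) :
    D.pairing (D.smulY w y) (w • x) = D.pairing y x := D.pairing_smulY w y x

theorem pairing_smulY_left (w : D.weylGroup) (y : Y) (x : X) :
    D.pairing (D.smulY w y) x = D.pairing y (w⁻¹ • x) := by
  rw [← pairing_smulY_smul D w y, smul_inv_smul]

@[simp] theorem pairing_coroot_self (β : D.realRoots) : D.pairing (D.coroot β) (β : X) = 2 := by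
  conv_lhs => rw [D.rep_spec β]
  rw [coroot, D.pairing_smulY, D.pairing_simple, D.isGCM.diag]

theorem reflection_smul_self (β : D.realRoots) : D.reflection β • (β : X) = -(β : X) := by
  rw [reflection_smul, pairing_coroot_self]
  module

@[simp] theorem reflection_mul_self (β : D.realRoots) : D.reflection β * D.reflection β = 1 := by
  refine D.ext_smul fun x => ?_
  rw [mul_smul, one_smul, reflection_smul, reflection_smul]
  simp only [map_sub, map_smul, smul_eq_mul, pairing_coroot_self]
  module

@[simp] theorem reflection_inv (β : D.realRoots) : (D.reflection β)⁻¹ = D.reflection β :=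
  inv_eq_of_mul_eq_one_right (D.reflection_mul_self β)

/-- The coroot of a real root is determined by the root. -/
theorem eq_coroot {β : D.realRoots} {w : D.weylGroup} {y : Y}
    (hw : ∀ x : X, w • x = x - D.pairing y x • (β : X)) (hy : D.pairing y β = 2) :
    y = D.coroot β := by
  obtain ⟨v, i, hβ⟩ := id β.2
  change (β : X) = v • D.simpleRoot i at hβ
  let g : X → ℤ := fun x => D.pairing (D.coroot β) x - D.pairing y x
  have ht : ∀ x : X, (w * D.reflection β) • x = x + g x • (β : X) := by
    intro x
    rw [mul_smul, reflection_smul, hw]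
    simp only [map_sub, map_smul, hy, smul_eq_mul, g]
    module
  have hu : ∀ x : X, (v⁻¹ * (w * D.reflection β) * v) • x = x + g (v • x) • D.simpleRoot i := by
    intro x
    rw [mul_smul, mul_smul, ht, smul_add, inv_smul_smul, hβ, ← smul_comm, inv_smul_smul]
  -- The quotient of the two reflections is a transvection along `β`. Conjugated so that `β` becomes
  -- `α_i`, it adds multiples of `α_i`, hence inverts no positive root and is trivial.
  have h1 : v⁻¹ * (w * D.reflection β) * v = 1 := by
    refine D.eq_one_of_inv (Set.eq_empty_of_forall_notMem fun γ hγ => ?_)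
    obtain ⟨h1, h2⟩ := D.mem_inv.1 hγ
    have h3 := D.smul_mem_realRoots (v⁻¹ * (w * D.reflection β) * v) h1.1
    rw [hu] at h2 h3
    by_cases hγi : γ = D.simpleRoot i
    · have : g (v • γ) = 0 := by
        rw [hγi, ← hβ]
        simp [g, hy]
      rw [this, zero_smul, add_zero] at h2
      exact D.not_pos_and_neg h1 h2
    · exact D.not_pos_and_neg (D.add_smul_simpleRoot_pos h1 hγi h3) h2
  refine D.eq_of_pairing_eq fun x => ?_
  have h2 := hu (v⁻¹ • x)
  rw [h1, one_smul, smul_inv_smul, left_eq_add, ← Int.cast_smul_eq_zsmul ℤ] at h2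
  have := (smul_eq_zero.1 h2).resolve_right (D.simpleRoot_ne_zero i)
  simp only [g, Int.cast_id] at this
  omega

theorem reflection_smul_root (w : D.weylGroup) (β : D.realRoots) :
    D.reflection (w • β) = w * D.reflection β * w⁻¹ ∧
      D.coroot (w • β) = D.smulY w (D.coroot β) := by
  have h : ∀ x : X, (w * D.reflection β * w⁻¹) • x =
      x - D.pairing (D.smulY w (D.coroot β)) x • ((w • β : D.realRoots) : X) := by
    intro x
    rw [mul_smul, mul_smul, reflection_smul, smul_sub, smul_inv_smul, smul_comm,
      pairing_smulY_left, coe_smul_root]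
  have h2 : D.smulY w (D.coroot β) = D.coroot (w • β) :=
    D.eq_coroot h (by rw [coe_smul_root, pairing_smulY_smul, pairing_coroot_self])
  refine ⟨D.ext_smul fun x => ?_, h2.symm⟩
  rw [h, reflection_smul, h2]

theorem reflection_smul_eq (w : D.weylGroup) (β : D.realRoots) :
    D.reflection (w • β) = w * D.reflection β * w⁻¹ := (D.reflection_smul_root w β).1

theorem coroot_smul (w : D.weylGroup) (β : D.realRoots) :
    D.coroot (w • β) = D.smulY w (D.coroot β) := (D.reflection_smul_root w β).2

@[simp] theorem coroot_neg (β : D.realRoots) : D.coroot (-β) = -D.coroot β := by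
  refine (D.eq_coroot (w := D.reflection β) (fun x => ?_) ?_).symm
  · rw [reflection_smul]
    simp
  · simp

@[simp] theorem reflection_neg (β : D.realRoots) : D.reflection (-β) = D.reflection β := by
  refine D.ext_smul fun x => ?_
  rw [reflection_smul, reflection_smul]
  simp

/-! ### Reflections and length -/

theorem sum_pos_ne_neg {a b : X} (ha : a ∈ D.posRoots) (hb : b ∈ D.posRoots)
    (h : -(a + b) ∈ D.posCone) : False := by
  have h1 := D.posCone_antisymm (add_mem ha.2 hb.2) h
  exact D.not_pos_and_neg ha (eq_neg_of_add_eq_zero_right h1 ▸ hb)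

theorem zsmul_mem_posCone {x : X} (hx : x ∈ D.posCone) {n : ℤ} (hn : 0 ≤ n) :
    n • x ∈ D.posCone := by
  lift n to ℕ using hn
  rw [natCast_zsmul]
  exact nsmul_mem hx n

theorem pairing_pos_of_mem_inv {δ : D.realRoots} (hδ : (δ : X) ∈ D.posRoots) {η : X}
    (h : η ∈ D.inv (D.reflection δ)) : 0 < D.pairing (D.coroot δ) η := by
  obtain ⟨h1, h2⟩ := D.mem_inv.1 h
  by_contra! hc
  refine D.realRoot_ne_zero h2.1 (D.posCone_antisymm h2.2 ?_)
  rw [neg_neg, reflection_smul, sub_eq_add_neg, ← neg_smul]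
  exact add_mem h1.2 (D.zsmul_mem_posCone hδ.2 (by omega))

theorem reflection_smul_smul (δ : D.realRoots) (x : X) :
    D.reflection δ • D.reflection δ • x = x := by
  rw [smul_smul, reflection_mul_self, one_smul]

open Classical in
/-- The involution of the positive roots that is `s_δ` outside of the inversion set of `s_δ`. -/
noncomputable def flip (δ : D.realRoots) (β : X) : X :=
  if β ∈ D.inv (D.reflection δ) then β else D.reflection δ • β

theorem flip_notMem {δ : D.realRoots} {β : X} (hβ : β ∈ D.posRoots)
    (h : β ∉ D.inv (D.reflection δ)) :
    D.reflection δ • β ∈ D.posRoots ∧ D.reflection δ • β ∉ D.inv (D.reflection δ) := by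
  have h1 : D.reflection δ • β ∈ D.posRoots :=
    (D.pos_or_neg (D.smul_mem_realRoots _ hβ.1)).resolve_right fun h' => h ⟨hβ, h'⟩
  refine ⟨h1, fun h2 => ?_⟩
  have h3 := (D.mem_inv.1 h2).2
  rw [reflection_smul_smul] at h3
  exact D.not_pos_and_neg hβ h3

theorem flip_injOn (δ : D.realRoots) : Set.InjOn (D.flip δ) D.posRoots := by
  intro β hβ γ hγ h
  unfold flip at h
  split_ifs at h with h1 h2 h2
  · exact h
  · exact absurd (h ▸ h1) (D.flip_notMem hγ h2).2
  · exact absurd (h ▸ h2) (D.flip_notMem hβ h1).2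
  · exact MulAction.injective _ h

/-- Lengths are compared by counting: `flip δ` injects the inversions of `w s_δ` into those of `w`
other than `δ`. -/
theorem length_mul_reflection_lt {δ : D.realRoots} (hδ : (δ : X) ∈ D.posRoots) {w : D.weylGroup}
    (h : -(w • (δ : X)) ∈ D.posRoots) : D.length (w * D.reflection δ) < D.length w := by
  have hsub : D.flip δ '' D.inv (w * D.reflection δ) ⊆ D.inv w \ {(δ : X)} := by
    rintro _ ⟨β, hβ, rfl⟩
    obtain ⟨h1, h2⟩ := D.mem_inv.1 hβ
    rw [mul_smul] at h2
    unfold flip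
    split_ifs with hS
    · refine ⟨⟨h1, ?_⟩, ?_⟩
      · refine (D.pos_or_neg (D.smul_mem_realRoots w h1.1)).resolve_left fun h3 => ?_
        refine D.sum_pos_ne_neg h3 h2 ?_
        have h4 : -(w • β + -(w • D.reflection δ • β)) =
            D.pairing (D.coroot δ) β • -(w • (δ : X)) := by
          rw [reflection_smul, smul_sub, smul_comm w]
          generalize w • β = p
          generalize w • (δ : X) = q
          module
        rw [h4]
        exact D.zsmul_mem_posCone h.2 (D.pairing_pos_of_mem_inv hδ hS).le
      · rintro rfl
        rw [reflection_smul_self, smul_neg, neg_neg] at h2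
        exact D.not_pos_and_neg h2 h
    · refine ⟨⟨(D.flip_notMem h1 hS).1, h2⟩, ?_⟩
      rintro h3
      rw [Set.mem_singleton_iff] at h3
      have : β = -(δ : X) := by rw [← reflection_smul_self, ← h3, reflection_smul_smul]
      exact D.not_pos_and_neg hδ (this ▸ h1)
  have h1 := Set.ncard_le_ncard hsub ((D.inv_finite w).sdiff)
  rw [Set.InjOn.ncard_image ((D.flip_injOn δ).mono fun _ h => h.1),
    Set.ncard_sdiff_singleton_of_mem (show (δ : X) ∈ D.inv w from ⟨hδ, h⟩), ncard_inv,
    ncard_inv] at h1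
  have h2 : 0 < (D.inv w).ncard :=
    (Set.ncard_pos (D.inv_finite w)).2 ⟨δ, ⟨hδ, h⟩⟩
  rw [ncard_inv] at h2
  omega

theorem length_lt_mul_reflection {δ : D.realRoots} (hδ : (δ : X) ∈ D.posRoots) {w : D.weylGroup}
    (h : w • (δ : X) ∈ D.posRoots) : D.length w < D.length (w * D.reflection δ) := by
  have := D.length_mul_reflection_lt (w := w * D.reflection δ) hδ
    (by rwa [mul_smul, reflection_smul_self, smul_neg, neg_neg])
  rwa [mul_assoc, reflection_mul_self, mul_one] at this

/-- Without such an `η`, `flip δ` would also inject the inversions of `w` other than `δ` into those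
of `w s_δ`, so the length would drop by at most one. -/
theorem exists_pair_of_length {δ : D.realRoots} (hδ : (δ : X) ∈ D.posRoots) {w : D.weylGroup}
    (h : -(w • (δ : X)) ∈ D.posRoots)
    (hl : D.length (w * D.reflection δ) + 1 < D.length w) :
    ∃ η ∈ D.inv (D.reflection δ), η ≠ δ ∧ -(w • η) ∈ D.posRoots ∧
      w • D.reflection δ • η ∈ D.posRoots := by
  by_contra! hno
  have hsub : D.flip δ '' (D.inv w \ {(δ : X)}) ⊆ D.inv (w * D.reflection δ) := by
    rintro _ ⟨β, ⟨hβ, hne⟩, rfl⟩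
    obtain ⟨h1, h2⟩ := D.mem_inv.1 hβ
    unfold flip
    split_ifs with hS
    · refine ⟨h1, ?_⟩
      have := hno β hS hne h2
      change -((w * D.reflection δ) • β) ∈ D.posRoots
      rw [mul_smul]
      exact (D.pos_or_neg (D.smul_mem_realRoots _ (D.smul_mem_realRoots _ h1.1))).resolve_left this
    · refine ⟨(D.flip_notMem h1 hS).1, ?_⟩
      change -((w * D.reflection δ) • D.reflection δ • β) ∈ D.posRoots
      rwa [mul_smul, reflection_smul_smul]
  have h1 := Set.ncard_le_ncard hsub (D.inv_finite _)
  rw [Set.InjOn.ncard_image ((D.flip_injOn δ).mono fun _ h => h.1.1),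
    Set.ncard_sdiff_singleton_of_mem (show (δ : X) ∈ D.inv w from ⟨hδ, h⟩), ncard_inv,
    ncard_inv] at h1
  omega

/-! ### Finiteness of the set of quantum roots -/

/-- If `s_β α_j` were positive, so would be `r_j s_β α_j`; but this is `-α_j` minus a positive
multiple of the positive root `r_j β`. -/
theorem reflection_smul_simpleRoot_neg {β : D.realRoots} (hβ : (β : X) ∈ D.posRoots) {j : I}
    (hne : (β : X) ≠ D.simpleRoot j) (h : 0 < D.pairing (D.coroot β) (D.simpleRoot j)) :
    D.simpleRoot j ∈ D.inv (D.reflection β) := by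
  refine ⟨D.simpleRoot_mem_posRoots j, ?_⟩
  have hr := D.smul_mem_realRoots (D.reflection β) (D.simpleRoot_mem_realRoots j)
  refine (D.pos_or_neg hr).resolve_left fun hp => ?_
  by_cases hj : D.reflection β • D.simpleRoot j = D.simpleRoot j
  · rw [reflection_smul, sub_eq_self] at hj
    exact (smul_eq_zero.1 hj).elim h.ne' (D.realRoot_ne_zero β.2)
  · have h1 := D.r_smul_pos hp hj
    rw [reflection_smul, smul_sub, r_smul_self, smul_comm] at h1
    refine D.realRoot_ne_zero h1.1 (D.posCone_antisymm h1.2 ?_)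
    rw [neg_sub, sub_neg_eq_add]
    exact add_mem (D.zsmul_mem_posCone (D.r_smul_pos hβ hne).2 h.le) (D.simpleRoot_mem_posCone j)

theorem IsQuantum.pairing_simpleRoot_le {D : KacMoodyRootDatum I X Y} {β : D.realRoots}
    (hβ : D.IsQuantum β) (j : I) : D.pairing (D.coroot β) (D.simpleRoot j) ≤ 2 := by
  by_contra! h
  by_cases hne : (β : X) = D.simpleRoot j
  · rw [← hne, pairing_coroot_self] at h
    omega
  · have := hβ.2 _ ⟨D.reflection_smul_simpleRoot_neg hβ.1 hne (by omega), Ne.symm hne⟩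
    omega

/-- Evaluating the inequality of coroots at `γ` and `β` gives `c ≥ 2` and `d ≤ 2`. Since `β` is
quantum, `c ≥ 2` forces `s_β γ` to be positive. Evaluating there rules out `d ≤ 1`, while `d = 2`
contradicts quantumness of `γ`. -/
theorem not_isQuantum_of_pairing_le {β γ : D.realRoots} (hne : β ≠ γ) (hβ : D.IsQuantum β)
    (hγ : D.IsQuantum γ)
    (h : ∀ j, D.pairing (D.coroot γ) (D.simpleRoot j) ≤
      D.pairing (D.coroot β) (D.simpleRoot j)) : False := by
  have hne' : (γ : X) ≠ β := fun h => hne (Subtype.ext h.symm)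
  have hcone : ∀ x ∈ D.posCone, D.pairing (D.coroot γ) x ≤ D.pairing (D.coroot β) x := by
    intro x hx
    induction hx using AddSubmonoid.closure_induction with
    | mem x h' =>
      obtain ⟨j, rfl⟩ := h'
      exact h j
    | zero => simp
    | add x y _ _ h1 h2 => simpa using add_le_add h1 h2
  obtain ⟨c, hc⟩ : ∃ c, c = D.pairing (D.coroot β) γ := ⟨_, rfl⟩
  obtain ⟨d, hd⟩ : ∃ d, d = D.pairing (D.coroot γ) β := ⟨_, rfl⟩
  have hc2 : 2 ≤ c := by
    have := hcone γ hγ.1.2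
    rwa [pairing_coroot_self, ← hc] at this
  have hd2 : d ≤ 2 := by
    have := hcone β hβ.1.2
    rwa [pairing_coroot_self, ← hd] at this
  have hζ : D.reflection β • (γ : X) ∈ D.posRoots := by
    refine (D.pos_or_neg (D.smul_mem_realRoots _ γ.2)).resolve_right fun hn => ?_
    have := hβ.2 γ ⟨⟨hγ.1, hn⟩, hne'⟩
    omega
  have hζ' : D.reflection β • (γ : X) = γ - c • (β : X) := by rw [reflection_smul, hc]
  by_cases hd1 : d ≤ 1
  · have := hcone _ hζ.2
    rw [hζ'] at this
    simp only [map_sub, map_smul, pairing_coroot_self, ← hc, ← hd, smul_eq_mul] at this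
    nlinarith
  · have hd' : d = 2 := by omega
    have hβγ : (β : X) ∈ D.inv (D.reflection γ) := by
      refine ⟨hβ.1, ?_⟩
      refine (D.pos_or_neg (D.smul_mem_realRoots _ β.2)).resolve_left fun hp => ?_
      -- With `d = 2`, the sum of `s_γ β = β - 2γ` and `2 s_β γ = 2γ - 2cβ` is `-(2c - 1)β`, so `s_γ
      -- β` cannot be positive.
      have h1 : (2 * c - 1) • (β : X) ∈ D.posCone := D.zsmul_mem_posCone hβ.1.2 (by omega)
      have h2 : -((2 * c - 1) • (β : X)) ∈ D.posCone := by
        have : -((2 * c - 1) • (β : X)) =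
            D.reflection γ • (β : X) + (2 : ℤ) • (D.reflection β • (γ : X)) := by
          rw [hζ', reflection_smul, ← hd, hd']
          module
        rw [this]
        exact add_mem hp.2 (D.zsmul_mem_posCone hζ.2 (by norm_num))
      exact (smul_eq_zero.1 (D.posCone_antisymm h1 h2)).elim (by omega) (D.realRoot_ne_zero β.2)
    have := hγ.2 β ⟨hβγ, hne'.symm⟩
    omega

/-- Dickson's lemma for the vectors `2 - ⟨β^∨, α_j⟩`, which are natural numbers by
`pairing_simpleRoot_le`, so `toNat` loses nothing. -/
theorem finite_quantumRoots : D.quantumRoots.Finite := by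
  by_contra hinf
  let f := Set.Infinite.natEmbedding _ hinf
  let g : ℕ → I → ℕ := fun n j =>
    (2 - D.pairing (D.coroot (f n).1) (D.simpleRoot j)).toNat
  obtain ⟨m, n, hmn, hle⟩ := wellQuasiOrdered_le g
  refine D.not_isQuantum_of_pairing_le (β := (f m).1) (γ := (f n).1)
    (fun h => hmn.ne (f.injective (Subtype.ext h))) (f m).2 (f n).2 fun j => ?_
  have h1 := hle j
  have h2 := (f m).2.pairing_simpleRoot_le j
  have h3 := (f n).2.pairing_simpleRoot_le j
  simp only [g] at h1
  omega

/-! ### The Tits cone -/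

theorem smulY_mul (v w : D.weylGroup) (y : Y) : D.smulY (v * w) y = D.smulY v (D.smulY w y) := by
  simp [smulY]

@[simp] theorem smulY_one (y : Y) : D.smulY 1 y = y := by simp [smulY]

theorem smulY_add (w : D.weylGroup) (y z : Y) :
    D.smulY w (y + z) = D.smulY w y + D.smulY w z := by simp [smulY]

theorem smulY_zsmul (w : D.weylGroup) (n : ℤ) (y : Y) : D.smulY w (n • y) = n • D.smulY w y := by
  simp [smulY, ofAdd_zsmul]

theorem smulY_reflection (β : D.realRoots) (y : Y) :
    D.smulY (D.reflection β) y = y - D.pairing y (β : X) • D.coroot β := by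
  refine D.eq_of_pairing_eq fun x => ?_
  rw [pairing_smulY_left, reflection_inv, reflection_smul]
  simp [mul_comm]

theorem pairing_nonneg_of_dominant {y : Y} (hy : y ∈ D.dominant) {x : X} (hx : x ∈ D.posCone) :
    0 ≤ D.pairing y x := by
  induction hx using AddSubmonoid.closure_induction with
  | mem x h =>
    obtain ⟨j, rfl⟩ := h
    exact hy j
  | zero => simp
  | add x z _ _ h1 h2 => simpa using add_nonneg h1 h2

/-- The positive real roots on which `y` takes a negative value. -/
def negSet (y : Y) : Set X := {ζ | ζ ∈ D.posRoots ∧ D.pairing y ζ < 0}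

theorem negSet_finite {y : Y} (hy : y ∈ D.titsCone) : (D.negSet y).Finite := by
  obtain ⟨w, y₀, hy₀, rfl⟩ := hy
  refine (D.inv_finite w⁻¹).subset fun ζ ⟨h1, h2⟩ => ⟨h1, ?_⟩
  refine (D.pos_or_neg (D.smul_mem_realRoots _ h1.1)).resolve_left fun h3 => ?_
  rw [pairing_smulY_left] at h2
  exact absurd (D.pairing_nonneg_of_dominant hy₀ h3.2) (not_le.2 h2)

theorem smulY_mem_titsCone (w : D.weylGroup) {y : Y} (hy : y ∈ D.titsCone) :
    D.smulY w y ∈ D.titsCone := by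
  obtain ⟨v, y₀, hy₀, rfl⟩ := hy
  exact ⟨w * v, y₀, hy₀, (D.smulY_mul _ _ _).symm⟩

/-- Reflecting in a simple root on which `y` is negative removes that root from the finite set and
permutes the others, so the process ends at a dominant element. Together with `negSet_finite` this
characterizes the Tits cone. -/
theorem mem_titsCone_of_finite {y : Y} (hy : (D.negSet y).Finite) : y ∈ D.titsCone := by
  induction hn : (D.negSet y).ncard using Nat.strong_induction_on generalizing y with
  | _ n ih =>
  subst hn
  by_cases hd : y ∈ D.dominant
  · exact ⟨1, y, hd, by simp⟩
  simp only [dominant, Set.mem_ofPred_eq, not_forall, not_le] at hd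
  obtain ⟨i, hi⟩ := hd
  have hsub : (D.r i • ·) '' D.negSet (D.smulY (D.r i) y) ⊆ D.negSet y \ {D.simpleRoot i} := by
    rintro _ ⟨ζ, ⟨h1, h2⟩, rfl⟩
    rw [pairing_smulY_left, r_inv] at h2
    have hζ : ζ ≠ D.simpleRoot i := by
      rintro rfl
      rw [r_smul_self, map_neg] at h2
      omega
    refine ⟨⟨D.r_smul_pos h1 hζ, h2⟩, fun h3 => ?_⟩
    have : ζ = -D.simpleRoot i := by
      rw [← r_smul_self, ← Set.mem_singleton_iff.1 h3, smul_smul, r_mul_r, one_smul]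
    exact D.not_pos_and_neg h1 (this ▸ by simpa using D.simpleRoot_mem_posRoots i)
  have hfin : (D.negSet (D.smulY (D.r i) y)).Finite :=
    Set.Finite.of_finite_image (hy.sdiff.subset hsub) (MulAction.injective _).injOn
  have hmem : D.simpleRoot i ∈ D.negSet y := ⟨D.simpleRoot_mem_posRoots i, hi⟩
  have hlt : (D.negSet (D.smulY (D.r i) y)).ncard < (D.negSet y).ncard := by
    have h1 := Set.ncard_le_ncard hsub hy.sdiff
    rw [Set.ncard_image_of_injective _ (MulAction.injective _)] at h1
    exact h1.trans_lt (Set.ncard_sdiff_singleton_lt_of_mem hmem hy)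
  have := D.smulY_mem_titsCone (D.r i) (ih _ hlt hfin rfl)
  rwa [← smulY_mul, r_mul_r, smulY_one] at this

/-- Convexity of the Tits cone: the element lies on the segment from `s_β y` to `y`, and a root
negative on it is negative at an endpoint. -/
theorem segment_mem_titsCone {y : Y} (hy : y ∈ D.titsCone) (β : D.realRoots) {n : ℤ} (h0 : 0 ≤ n)
    (hn : n ≤ D.pairing y (β : X)) :
    D.smulY (D.reflection β) y + n • D.coroot β ∈ D.titsCone := by
  set q := D.pairing y (β : X) with hq
  rcases eq_or_lt_of_le (h0.trans hn) with hq0 | hq0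
  · have : n = 0 := by omega
    simpa [this] using D.smulY_mem_titsCone _ hy
  refine D.mem_titsCone_of_finite (((D.negSet_finite hy).union
    (D.negSet_finite (D.smulY_mem_titsCone (D.reflection β) hy))).subset ?_)
  rintro ζ ⟨h1, h2⟩
  by_contra hcon
  simp only [negSet, Set.mem_union, Set.mem_ofPred_eq, h1, true_and, not_or, not_lt] at hcon
  obtain ⟨h3, h4⟩ := hcon
  rw [smulY_reflection] at h2 h4
  simp only [map_sub, map_add, map_smul, LinearMap.sub_apply, LinearMap.add_apply,
    LinearMap.smul_apply, smul_eq_mul, ← hq] at h2 h4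
  -- `q` times the intermediate point equals `n y + (q - n) s_β y`.
  have h5 := mul_nonneg h0 h3
  have h6 := mul_nonneg (sub_nonneg.2 hn) h4
  nlinarith

/-! ### Affine roots -/

theorem smul_left_apply (x y : D.ExtAffineWeylGroup) :
    (x * y).left.toAdd = x.left.toAdd + D.smulY x.right y.left.toAdd := rfl

theorem affineAct_mul (x y : D.ExtAffineWeylGroup) (v : X × ℤ) :
    D.affineAct (x * y) v = D.affineAct x (D.affineAct y v) := by
  refine Prod.ext rfl ?_
  change v.2 + D.pairing (x * y).left.toAdd ((x.right * y.right) • v.1) =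
    v.2 + D.pairing y.left.toAdd (y.right • v.1) +
      D.pairing x.left.toAdd (x.right • y.right • v.1)
  rw [smul_left_apply, mul_smul, map_add, LinearMap.add_apply, pairing_smulY_smul]
  ring

noncomputable instance : DistribMulAction D.ExtAffineWeylGroup (X × ℤ) where
  smul := D.affineAct
  one_smul v := Prod.ext rfl (by
    change v.2 + D.pairing 0 _ = v.2
    simp)
  mul_smul x y v := D.affineAct_mul x y v
  smul_zero x := Prod.ext (smul_zero x.right) (by
    change 0 + D.pairing _ (x.right • (0 : X)) = 0
    simp)
  smul_add x v w := Prod.ext (smul_add x.right v.1 w.1) (by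
    change v.2 + w.2 + D.pairing _ (x.right • (v.1 + w.1)) =
      v.2 + D.pairing _ (x.right • v.1) + (w.2 + D.pairing _ (x.right • w.1))
    rw [smul_add, map_add]
    ring)

theorem affine_smul_snd (x : D.ExtAffineWeylGroup) (v : X × ℤ) :
    (x • v).2 = v.2 + D.pairing x.left.toAdd (x.right • v.1) := rfl

theorem affine_inv_smul_fst (x : D.ExtAffineWeylGroup) (v : X × ℤ) :
    (x⁻¹ • v).1 = x.right⁻¹ • v.1 := rfl

theorem affine_inv_smul_snd (x : D.ExtAffineWeylGroup) (v : X × ℤ) :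
    (x⁻¹ • v).2 = v.2 - D.pairing x.left.toAdd v.1 := by
  have h : v = x • (x⁻¹ • v) := (smul_inv_smul x v).symm
  have h2 := congrArg Prod.snd h
  rw [affine_smul_snd, affine_inv_smul_fst, smul_inv_smul] at h2
  omega

/-- Affine real roots. -/
abbrev AffRoot : Type _ := D.realRoots × ℤ

variable {D} in
/-- An affine root as a vector of `X × ℤ`. -/
def vec (b : D.AffRoot) : X × ℤ := (b.1, b.2)

variable {D} in
/-- The affine reflection of an affine root. -/
noncomputable def aff (b : D.AffRoot) : D.ExtAffineWeylGroup := D.affineReflection b.1 b.2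

variable {D} in
/-- The value on a vector of the coroot of an affine root. -/
noncomputable def cp (a : D.AffRoot) (v : X × ℤ) : ℤ := D.pairing (D.coroot a.1) v.1

variable {D} in
/-- The image of an affine root `b` under the reflection of `a`. -/
noncomputable def refl (a b : D.AffRoot) : D.AffRoot :=
  (D.reflection a.1 • b.1, b.2 - cp a (vec b) * a.2)

@[simp] theorem vec_neg (b : D.AffRoot) : vec (-b) = -vec b := rfl

theorem vec_refl (a b : D.AffRoot) : vec (refl a b) = vec b - cp a (vec b) • vec a :=
  Prod.ext (D.reflection_smul _ _) rfl

theorem cp_sub (a : D.AffRoot) (v w : X × ℤ) : cp a (v - w) = cp a v - cp a w := map_sub _ _ _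

theorem cp_neg (a : D.AffRoot) (v : X × ℤ) : cp a (-v) = -cp a v := map_neg _ _

theorem cp_zsmul (a : D.AffRoot) (n : ℤ) (v : X × ℤ) : cp a (n • v) = n * cp a v :=
  (D.pairing (D.coroot a.1)).map_smul n v.1

@[simp] theorem cp_self (a : D.AffRoot) : cp a (vec a) = 2 := D.pairing_coroot_self _

theorem cp_neg_left (a : D.AffRoot) (v : X × ℤ) : cp (-a) v = -cp a v := by
  change D.pairing (D.coroot (-a.1)) v.1 = _
  rw [coroot_neg]
  simp [cp]

theorem cp_refl (a b : D.AffRoot) (v : X × ℤ) :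
    cp (refl a b) v = cp b (v - cp a v • vec a) := by
  change D.pairing (D.coroot (D.reflection a.1 • b.1)) v.1 = _
  rw [coroot_smul, pairing_smulY_left, reflection_inv, reflection_smul]
  rfl

theorem aff_smul (a : D.AffRoot) (v : X × ℤ) : aff a • v = v - cp a v • vec a := by
  refine Prod.ext (D.reflection_smul _ _) ?_
  rw [affine_smul_snd]
  change v.2 + D.pairing (a.2 • D.coroot a.1) (D.reflection a.1 • v.1) = v.2 - cp a v • a.2
  rw [reflection_smul]
  simp only [map_smul, map_sub, LinearMap.smul_apply, pairing_coroot_self, smul_eq_mul, cp]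
  ring

theorem aff_smul_vec (a b : D.AffRoot) : aff a • vec b = vec (refl a b) := by
  rw [aff_smul, vec_refl]

theorem ofPair_mul (y z : Y) (v w : D.weylGroup) :
    D.ofPair y v * D.ofPair z w = D.ofPair (y + D.smulY v z) (v * w) := rfl

theorem aff_mul_self (a : D.AffRoot) : aff a * aff a = 1 := by
  change D.ofPair _ _ * D.ofPair _ _ = D.ofPair 0 1
  rw [ofPair_mul, reflection_mul_self, smulY_reflection]
  congr 1
  simp only [map_smul, LinearMap.smul_apply, pairing_coroot_self]
  module

theorem aff_mul_aff_mul_aff (a b : D.AffRoot) : aff a * aff b * aff a = aff (refl a b) := by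
  change D.ofPair _ _ * D.ofPair _ _ * D.ofPair _ _ = D.ofPair _ _
  rw [ofPair_mul, ofPair_mul]
  congr 1
  · change _ = (b.2 - cp a (vec b) * a.2) • D.coroot (D.reflection a.1 • b.1)
    refine D.eq_of_pairing_eq fun x => ?_
    rw [coroot_smul, smulY_mul]
    simp only [smulY_reflection, map_sub, map_add, map_smul, LinearMap.smul_apply, cp,
      LinearMap.sub_apply, LinearMap.add_apply, pairing_coroot_self, smul_eq_mul, vec]
    ring
  · change _ = D.reflection (D.reflection a.1 • b.1)
    rw [reflection_smul_eq, reflection_inv]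

theorem aff_inv (a : D.AffRoot) : (aff a)⁻¹ = aff a :=
  inv_eq_of_mul_eq_one_right (D.aff_mul_self a)

@[simp] theorem aff_neg (a : D.AffRoot) : aff (-a) = aff a := by
  change D.ofPair (-a.2 • D.coroot (-a.1)) (D.reflection (-a.1)) = D.ofPair _ _
  rw [coroot_neg, reflection_neg]
  simp

theorem vec_injective : Function.Injective (vec (D := D)) := fun _ _ h =>
  Prod.ext (Subtype.ext (congrArg (fun v : X × ℤ => v.1) h)) (congrArg (fun v : X × ℤ => v.2) h)

theorem neg_refl_neg_refl (a b : D.AffRoot) : -refl a (-refl a b) = b := by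
  refine D.vec_injective ?_
  simp only [vec_neg, vec_refl, cp_neg, cp_sub, cp_zsmul, cp_self]
  module

/-! ### Pairs of roots exchanged by a reflection -/

/-- A predicate on `X × ℤ` that splits the affine roots like the positivity of a linear order. -/
structure IsPosSystem (S : X × ℤ → Prop) : Prop where
  add : ∀ {v w}, S v → S w → S (v + w)
  not_neg : ∀ {v}, S v → ¬ S (-v)
  total : ∀ b : D.AffRoot, S (vec b) ∨ S (-vec b)

variable {D} in
theorem IsPosSystem.not_zero {S : X × ℤ → Prop} (hS : D.IsPosSystem S) : ¬ S 0 := fun h =>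
  hS.not_neg h (by simpa using h)

variable {D} in
theorem IsPosSystem.zsmul {S : X × ℤ → Prop} (hS : D.IsPosSystem S) {v : X × ℤ} (hv : S v) {n : ℤ}
    (hn : 0 < n) : S (n • v) := by
  obtain ⟨m, rfl⟩ := Int.eq_succ_of_zero_lt hn
  clear hn
  induction m with
  | zero => simpa using hv
  | succ m ih =>
    have := hS.add ih hv
    convert this using 1
    push_cast
    module

variable {D} in
theorem IsPosSystem.pos_of_zsmul {S : X × ℤ → Prop} (hS : D.IsPosSystem S) {v : X × ℤ} (hv : S v)
    {n : ℤ} (hn : S (n • v)) : 0 < n := by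
  by_contra! h
  rcases eq_or_lt_of_le h with rfl | h
  · exact hS.not_zero (by simpa using hn)
  · exact hS.not_neg hn (by simpa using hS.zsmul hv (neg_pos.2 h))

theorem cp_neg_refl_right (a b : D.AffRoot) : cp (-refl a b) (vec a) = cp b (vec a) := by
  rw [cp_neg_left, cp_refl, cp_self, cp_sub, cp_zsmul]
  ring

theorem cp_neg_refl_left (a b : D.AffRoot) :
    cp (-refl b a) (vec a) = cp a (vec b) * cp b (vec a) - 2 := by
  rw [cp_neg_left, cp_refl, cp_sub, cp_zsmul, cp_self]
  ring

theorem cp_vec_neg_refl (a b : D.AffRoot) :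
    cp a (vec (-refl b a)) = cp a (vec b) * cp b (vec a) - 2 := by
  rw [vec_neg, vec_refl, cp_neg, cp_sub, cp_zsmul, cp_self]
  ring

/-- The map `b ↦ -s_b a` commutes with the involution `b ↦ -s_a b`; hence it preserves conditions
imposed on both members of such a pair. -/
theorem vec_neg_refl_neg_refl (a b : D.AffRoot) :
    vec (-refl a (-refl b a)) = vec (-refl (-refl a b) a) := by
  rw [vec_neg, vec_neg, D.vec_refl a, D.vec_refl (-refl a b), cp_vec_neg_refl, cp_neg_refl_right,
    vec_neg, vec_neg, vec_refl, vec_refl]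
  module

/-- Given a positive root `a` and a finite nonempty set of roots `b` such that `b` and `-s_a b` are
positive, one of these `b` satisfies that `s_b a` is positive for one of the two systems. -/
theorem exists_refl_pos {S₁ S₂ : X × ℤ → Prop} (h₁ : D.IsPosSystem S₁) (h₂ : D.IsPosSystem S₂)
    {a : D.AffRoot} (ha : S₁ (vec a)) {P : Set D.AffRoot}
    (hP : ∀ b, b ∈ P ↔ (S₁ (vec b) ∧ S₂ (vec b)) ∧
      (S₁ (vec (-refl a b)) ∧ S₂ (vec (-refl a b)))) (hfin : P.Finite)
    {b₀ : D.AffRoot} (hb₀ : b₀ ∈ P) (hne : (2 : ℤ) • vec b₀ ≠ cp a (vec b₀) • vec a) :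
    ∃ b ∈ P, S₁ (vec (refl b a)) ∨ S₂ (vec (refl b a)) := by
  by_contra! hno
  have hneg : ∀ b ∈ P, S₁ (vec (-refl b a)) ∧ S₂ (vec (-refl b a)) := fun b hb =>
    ⟨(h₁.total _).resolve_left (hno b hb).1, (h₂.total _).resolve_left (hno b hb).2⟩
  have hsymm : ∀ b ∈ P, -refl a b ∈ P := by
    intro b hb
    rw [hP] at hb ⊢
    rw [neg_refl_neg_refl]
    exact hb.symm
  -- Under the contrary assumption `b ↦ -s_b a` maps `P` to itself. The two bounds come from
  -- positivity of `-s_b a - s_{b'} a`, a multiple of `a` for `b' = -s_a b`, and of `a - s_b a`, a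
  -- multiple of `b`.
  have hT : ∀ b ∈ P, -refl b a ∈ P ∧ cp a (vec (-refl b a)) = cp a (vec b) * cp b (vec a) - 2 ∧
      cp (-refl b a) (vec a) = cp a (vec b) * cp b (vec a) - 2 ∧
      3 ≤ cp a (vec b) * cp b (vec a) ∧ 1 ≤ cp b (vec a) := by
    intro b hb
    have hb' := hsymm b hb
    have hd := D.cp_neg_refl_right a b
    have hcT := D.cp_vec_neg_refl a b
    have hv := D.vec_neg_refl_neg_refl a b
    refine ⟨?_, hcT, ?_, ?_, ?_⟩
    · rw [hP, hv]
      exact ⟨hneg b hb, hneg _ hb'⟩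
    · exact D.cp_neg_refl_left a b
    · have h := h₁.add (hneg b hb).1 (hneg _ hb').1
      have h' : vec (-refl b a) + vec (-refl (-refl a b) a) =
          (cp a (vec b) * cp b (vec a) - 2) • vec a := by
        rw [vec_neg, vec_neg, D.vec_refl b, D.vec_refl (-refl a b), hd, vec_neg, vec_refl]
        module
      rw [h'] at h
      have := h₁.pos_of_zsmul ha h
      omega
    · have h := h₁.add (hneg b hb).1 ha
      have h' : vec (-refl b a) + vec a = cp b (vec a) • vec b := by
        rw [vec_neg, vec_refl]
        module
      rw [h'] at h
      exact h₁.pos_of_zsmul ((hP b).1 hb).1.1 h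
  -- The vector `2b - ⟨a^∨, b⟩ a` is the part of `b` transverse to `a`; replacing `b` by `-s_b a`
  -- multiplies it by `⟨b^∨, a⟩`. A functional not vanishing on it for `b₀` measures the growth.
  obtain ⟨f, hf⟩ : ∃ f : Module.Dual ℤ (X × ℤ),
      f ((2 : ℤ) • vec b₀ - cp a (vec b₀) • vec a) ≠ 0 := by
    by_contra! h
    exact hne (sub_eq_zero.1 ((Module.forall_dual_apply_eq_zero_iff ℤ _).1 h))
  let F : D.AffRoot → ℤ := fun b => |f ((2 : ℤ) • vec b - cp a (vec b) • vec a)|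
  have hF : ∀ b ∈ P, F (-refl b a) = cp b (vec a) * F b := by
    intro b hb
    obtain ⟨-, h2, -, -, h5⟩ := hT b hb
    simp only [F]
    have : (2 : ℤ) • vec (-refl b a) - cp a (vec (-refl b a)) • vec a =
        cp b (vec a) • ((2 : ℤ) • vec b - cp a (vec b) • vec a) := by
      rw [h2, vec_neg, vec_refl]
      module
    rw [this, map_smul, smul_eq_mul, abs_mul, abs_of_pos (by omega)]
  obtain ⟨b, hb, hmax⟩ := Set.exists_max_image P F hfin ⟨b₀, hb₀⟩
  have hFb : 0 < F b := (abs_pos.2 hf).trans_le (hmax b₀ hb₀)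
  obtain ⟨hb1, h2, h3, h4, h5⟩ := hT b hb
  obtain ⟨hb2, -, -, h6, h7⟩ := hT _ hb1
  have h8 := hmax _ hb2
  rw [hF _ hb1, hF _ hb] at h8
  rw [h2, h3] at h6
  rw [h3] at h7 h8
  set m := cp a (vec b) * cp b (vec a) - 2
  -- Both pairings of `-s_b a` with `a` equal `m`, so the bounds in `hT` give `m² ≥ 3` and `m ≥ 1`.
  -- A second application then at least doubles the maximal value of `F`.
  have hm : 2 ≤ m := by nlinarith
  have h9 : F b ≤ cp b (vec a) * F b := le_mul_of_one_le_left hFb.le h5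
  nlinarith

/-! ### The affine Bruhat order -/

/-- Positivity of a vector of `X × ℤ`. -/
def IsAPos (v : X × ℤ) : Prop := 0 < v.2 ∨ (v.2 = 0 ∧ v.1 ∈ D.posCone ∧ v.1 ≠ 0)

theorem isAPos_vec (b : D.AffRoot) :
    D.IsAPos (vec b) ↔ 0 < b.2 ∨ (b.2 = 0 ∧ (b.1 : X) ∈ D.posRoots) :=
  or_congr Iff.rfl (and_congr Iff.rfl ⟨fun h => ⟨b.1.2, h.1⟩,
    fun h => ⟨h.2, D.realRoot_ne_zero b.1.2⟩⟩)

theorem isPosSystem_isAPos : D.IsPosSystem D.IsAPos where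
  add {v w} hv hw := by
    rcases hv with hv | ⟨hv, hv1, hv2⟩ <;> rcases hw with hw | ⟨hw, hw1, hw2⟩
    · exact Or.inl (add_pos hv hw)
    · exact Or.inl (by rw [Prod.snd_add]; omega)
    · exact Or.inl (by rw [Prod.snd_add]; omega)
    · refine Or.inr ⟨by rw [Prod.snd_add]; omega, add_mem hv1 hw1, fun h => hv2 ?_⟩
      exact D.posCone_antisymm hv1 (by
        rw [Prod.fst_add] at h
        rwa [neg_eq_of_add_eq_zero_right h])
  not_neg {v} hv hv' := by
    rcases hv with hv | ⟨hv, hv1, hv2⟩ <;> rcases hv' with hw | ⟨hw, hw1, hw2⟩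
    · rw [Prod.snd_neg] at hw; omega
    · rw [Prod.snd_neg] at hw; omega
    · rw [Prod.snd_neg] at hw; omega
    · exact hv2 (D.posCone_antisymm hv1 hw1)
  total b := by
    rw [← vec_neg, isAPos_vec, isAPos_vec]
    rcases lt_trichotomy b.2 0 with h | h | h
    · exact Or.inr (Or.inl (by rw [Prod.snd_neg]; omega))
    · rcases D.pos_or_neg b.1.2 with h' | h'
      · exact Or.inl (Or.inr ⟨h, h'⟩)
      · exact Or.inr (Or.inr ⟨by rw [Prod.snd_neg]; omega, h'⟩)
    · exact Or.inl (Or.inl h)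

/-- The action of the extended affine Weyl group on affine roots. -/
noncomputable def actRoot (x : D.ExtAffineWeylGroup) (b : D.AffRoot) : D.AffRoot :=
  (x.right • b.1, (x • vec b).2)

theorem vec_actRoot (x : D.ExtAffineWeylGroup) (b : D.AffRoot) :
    vec (D.actRoot x b) = x • vec b := rfl

theorem IsPosSystem.comap {S : X × ℤ → Prop} (hS : D.IsPosSystem S) (x : D.ExtAffineWeylGroup) :
    D.IsPosSystem (fun v => S (x • v)) where
  add hv hw := by
    rw [smul_add]
    exact hS.add hv hw
  not_neg hv := by
    rw [smul_neg]
    exact hS.not_neg hv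
  total b := by
    rw [smul_neg, ← vec_actRoot]
    exact hS.total _

theorem smul_vec_mem_posAffineRoots (x : D.ExtAffineWeylGroup) (b : D.AffRoot) :
    x • vec b ∈ D.posAffineRoots ↔ D.IsAPos (x • vec b) := by
  rw [← vec_actRoot, isAPos_vec]
  exact and_iff_right (D.actRoot x b).1.2

/-- The roots `β[n]` run over all positive affine roots: for `n < 0`, `β[n]` is the opposite of `(β,
n)` and has the same reflection. -/
theorem affineStep_iff {y x : D.affineWeyl} :
    D.affineStep y x ↔ ∃ b : D.AffRoot, D.IsAPos (vec b) ∧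
      (y : D.ExtAffineWeylGroup) = aff b * x ∧
      D.IsAPos (-((x : D.ExtAffineWeylGroup)⁻¹ • vec b)) := by
  have hnot : ∀ b : D.AffRoot, (D.affineAct (x : D.ExtAffineWeylGroup)⁻¹ (vec b) ∉
      D.posAffineRoots) ↔ D.IsAPos (-((x : D.ExtAffineWeylGroup)⁻¹ • vec b)) := by
    intro b
    rw [show D.affineAct (x : D.ExtAffineWeylGroup)⁻¹ (vec b) =
      (x : D.ExtAffineWeylGroup)⁻¹ • vec b from rfl, smul_vec_mem_posAffineRoots, ← vec_actRoot]
    exact ⟨fun h => (D.isPosSystem_isAPos.total _).resolve_left h,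
      fun h h' => D.isPosSystem_isAPos.not_neg h' h⟩
  constructor
  · rintro ⟨β, hβ, n, h1, h2⟩
    by_cases hn : 0 ≤ n
    · have : D.affineRoot β n = vec (D := D) (β, n) := by simp [affineRoot, vec, hn, abs_of_nonneg]
      rw [this, hnot] at h2
      refine ⟨(β, n), (D.isAPos_vec _).2 ?_, h1, h2⟩
      rcases eq_or_lt_of_le hn with h | h
      · exact Or.inr ⟨h.symm, hβ⟩
      · exact Or.inl h
    · have : D.affineRoot β n = vec (D := D) (-(β, n)) := by
        simp [affineRoot, vec, hn, abs_of_neg (not_le.1 hn)]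
      rw [this, hnot] at h2
      refine ⟨-(β, n), Or.inl ?_, ?_, h2⟩
      · change 0 < -n
        omega
      · rw [aff_neg]
        exact h1
  · rintro ⟨b, hb, h1, h2⟩
    rw [← hnot] at h2
    rw [isAPos_vec] at hb
    rcases D.pos_or_neg b.1.2 with hp | hp
    · refine ⟨b.1, hp, b.2, h1, ?_⟩
      have hn : 0 ≤ b.2 := hb.elim le_of_lt fun h => h.1.ge
      rwa [show D.affineRoot b.1 b.2 = vec b by simp [affineRoot, vec, hn, abs_of_nonneg]]
    · refine ⟨-b.1, hp, -b.2, ?_, ?_⟩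
      · rw [h1, ← aff_neg]
        rfl
      · have hn : 0 < b.2 := hb.resolve_right fun h => D.not_pos_and_neg h.2 hp
        rwa [show D.affineRoot (-b.1) (-b.2) = vec b by
          simp [affineRoot, vec, hn.not_ge, abs_of_pos hn]]

theorem aff_mul_left (b : D.AffRoot) (x : D.ExtAffineWeylGroup) :
    (aff b * x).left.toAdd =
      D.smulY (D.reflection b.1) x.left.toAdd + b.2 • D.coroot b.1 := by
  rw [smul_left_apply, add_comm]
  rfl

theorem isAPos_nonneg {v : X × ℤ} (h : D.IsAPos v) : 0 ≤ v.2 := h.elim le_of_lt fun h => h.1.ge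

/-- Going down along a reflection does not leave `W^+`. -/
theorem exists_step_down {x : D.affineWeyl} {b : D.AffRoot} (hb : D.IsAPos (vec b))
    (h : D.IsAPos (-((x : D.ExtAffineWeylGroup)⁻¹ • vec b))) :
    ∃ z : D.affineWeyl, (z : D.ExtAffineWeylGroup) = aff b * x ∧ D.affineStep z x := by
  have hmem : aff b * (x : D.ExtAffineWeylGroup) ∈ D.affineWeyl := by
    change (aff b * (x : D.ExtAffineWeylGroup)).left.toAdd ∈ D.titsCone
    rw [aff_mul_left]
    -- Negativity of `x⁻¹ b` bounds the height of `b`, so the new translation part stays on the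
    -- segment between the old one and its reflection.
    refine D.segment_mem_titsCone x.2 b.1 (D.isAPos_nonneg hb) ?_
    have h1 := D.isAPos_nonneg h
    rw [Prod.snd_neg, affine_inv_smul_snd] at h1
    change 0 ≤ -(b.2 - D.pairing _ (b.1 : X)) at h1
    omega
  exact ⟨⟨_, hmem⟩, rfl, D.affineStep_iff.2 ⟨b, hb, rfl, h⟩⟩

theorem mul_inv_smul_vec (a : D.AffRoot) (x : D.ExtAffineWeylGroup) (v : X × ℤ) :
    (aff a * x)⁻¹ • v = x⁻¹ • aff a • v := by
  rw [mul_inv_rev, mul_smul, aff_inv]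

theorem aff_smul_self (a : D.AffRoot) : aff a • vec a = -vec a := by
  rw [aff_smul, cp_self]
  module

/-! ### Intermediate elements between `x` and `s_a x` -/

theorem finite_of_bounded {F : Set X} (hF : F.Finite) (y : Y) :
    {b : D.AffRoot | (b.1 : X) ∈ F ∧ 0 ≤ b.2 ∧ b.2 ≤ D.pairing y (b.1 : X)}.Finite := by
  have hF' : (Subtype.val ⁻¹' F : Set D.realRoots).Finite :=
    hF.preimage Subtype.val_injective.injOn
  refine (hF'.biUnion fun β _ => (Set.finite_Icc 0 (D.pairing y (β : X))).image
    fun n => ((β, n) : D.AffRoot)).subset ?_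
  rintro ⟨β, n⟩ ⟨h1, h2, h3⟩
  exact Set.mem_biUnion (show β ∈ Subtype.val ⁻¹' F from h1) ⟨n, ⟨h2, h3⟩, rfl⟩

/-- Positivity of `b` and of `-y⁻¹ b` confines the height of `b`. If the direction of `b` is
negative, it is opposite to a root of the finite set `negSet`; if it is inverted by the reflection
of `a`, it lies in a finite inversion set; otherwise `-s_a b` falls in the first case. -/
theorem finite_pairs {x y : D.affineWeyl} {a : D.AffRoot}
    (hy : (y : D.ExtAffineWeylGroup) = aff a * x) :
    {b : D.AffRoot | (D.IsAPos (vec b) ∧ D.IsAPos ((x : D.ExtAffineWeylGroup)⁻¹ • vec b)) ∧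
      D.IsAPos (vec (-refl a b)) ∧
      D.IsAPos ((x : D.ExtAffineWeylGroup)⁻¹ • vec (-refl a b))}.Finite := by
  set P := {b : D.AffRoot | (D.IsAPos (vec b) ∧
    D.IsAPos ((x : D.ExtAffineWeylGroup)⁻¹ • vec b)) ∧ D.IsAPos (vec (-refl a b)) ∧
      D.IsAPos ((x : D.ExtAffineWeylGroup)⁻¹ • vec (-refl a b))} with hPdef
  have hle : ∀ b ∈ P, 0 ≤ b.2 ∧
      b.2 ≤ D.pairing (y : D.ExtAffineWeylGroup).left.toAdd (b.1 : X) := by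
    rintro b ⟨⟨h1, -⟩, -, h4⟩
    refine ⟨D.isAPos_nonneg h1, ?_⟩
    rw [vec_neg, ← aff_smul_vec, smul_neg, ← mul_inv_smul_vec, ← hy] at h4
    have h := D.isAPos_nonneg h4
    rw [Prod.snd_neg, affine_inv_smul_snd] at h
    change 0 ≤ -(b.2 - D.pairing _ (b.1 : X)) at h
    omega
  have hfin1 : {b ∈ P | -(b.1 : X) ∈ D.posRoots}.Finite := by
    refine (D.finite_of_bounded ((D.negSet_finite y.2).image Neg.neg)
      (y : D.ExtAffineWeylGroup).left.toAdd).subset ?_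
    rintro b ⟨hb, hneg⟩
    obtain ⟨h1, h2⟩ := hle b hb
    refine ⟨⟨-(b.1 : X), ⟨hneg, ?_⟩, neg_neg _⟩, h1, h2⟩
    have h3 : 0 < b.2 := ((D.isAPos_vec b).1 hb.1.1).resolve_right
      fun h => D.not_pos_and_neg h.2 hneg
    rw [map_neg]
    omega
  have hfin2 := D.finite_of_bounded (D.inv_finite (D.reflection a.1))
    (y : D.ExtAffineWeylGroup).left.toAdd
  refine ((hfin1.union (hfin1.image fun b => -refl a b)).union hfin2).subset fun b hb => ?_
  by_cases h1 : -(b.1 : X) ∈ D.posRoots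
  · exact Or.inl (Or.inl ⟨hb, h1⟩)
  by_cases h2 : (b.1 : X) ∈ D.inv (D.reflection a.1)
  · exact Or.inr ⟨h2, hle b hb⟩
  refine Or.inl (Or.inr ⟨-refl a b, ⟨?_, ?_⟩, D.neg_refl_neg_refl a b⟩)
  · refine ⟨hb.2, ?_⟩
    rw [neg_refl_neg_refl]
    exact hb.1
  · change -(-(D.reflection a.1 • (b.1 : X))) ∈ D.posRoots
    rw [neg_neg]
    exact (D.flip_notMem ((D.pos_or_neg b.1.2).resolve_right h1) h2).1

/-- `exists_refl_pos` is applied to positivity and to positivity after `x⁻¹`. The element found is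
`s_b x`; the chain is built downwards from `y`, because descending steps stay in `W^+`. -/
theorem exists_between {x y : D.affineWeyl} {a : D.AffRoot}
    (hy : (y : D.ExtAffineWeylGroup) = aff a * x) (ha : D.IsAPos (vec a))
    (ha' : D.IsAPos ((x : D.ExtAffineWeylGroup)⁻¹ • vec a)) {b₀ : D.AffRoot}
    (h1 : D.IsAPos (vec b₀)) (h2 : D.IsAPos ((x : D.ExtAffineWeylGroup)⁻¹ • vec b₀))
    (h3 : D.IsAPos (vec (-refl a b₀)))
    (h4 : D.IsAPos ((x : D.ExtAffineWeylGroup)⁻¹ • vec (-refl a b₀)))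
    (hne : (2 : ℤ) • vec b₀ ≠ cp a (vec b₀) • vec a) :
    ∃ z, D.affineBruhatLT x z ∧ D.affineBruhatLT z y := by
  obtain ⟨b, ⟨⟨hb1, hb2⟩, hb3, hb4⟩, hgood⟩ := D.exists_refl_pos D.isPosSystem_isAPos
    (D.isPosSystem_isAPos.comap D (x : D.ExtAffineWeylGroup)⁻¹) ha (fun _ => Iff.rfl)
    (D.finite_pairs hy) (b₀ := b₀) ⟨⟨h1, h2⟩, h3, h4⟩ hne
  have hlast : ∀ z : D.affineWeyl, (z : D.ExtAffineWeylGroup) = aff b * x → D.affineStep x z := by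
    intro z hz
    refine D.affineStep_iff.2 ⟨b, hb1, ?_, ?_⟩
    · rw [hz, ← mul_assoc, aff_mul_self, one_mul]
    · rwa [hz, mul_inv_smul_vec, aff_smul_self, smul_neg, neg_neg]
  rcases hgood with hg | hg
  -- When `s_b a` is positive: `y > s_b y > s_b x`, the second step along `s_b a`.
  · obtain ⟨z₂, hz₂, hs₂⟩ := D.exists_step_down (x := y) (b := b) hb1 (by
      rwa [hy, mul_inv_smul_vec, aff_smul_vec, ← smul_neg, ← vec_neg])
    obtain ⟨z₁, hz₁, hs₁⟩ := D.exists_step_down (x := z₂) (b := refl b a) hg (by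
      rw [hz₂, hy, mul_inv_smul_vec, mul_inv_smul_vec, ← aff_smul_vec, smul_smul (aff b),
        aff_mul_self, one_smul, aff_smul_self, smul_neg, neg_neg]
      exact ha')
    refine ⟨z₁, .single (hlast z₁ ?_), .tail (.single hs₁) hs₂⟩
    rw [hz₁, hz₂, hy, ← aff_mul_aff_mul_aff, mul_assoc, mul_assoc, ← mul_assoc (aff b) (aff b),
      aff_mul_self, one_mul, ← mul_assoc (aff a), aff_mul_self, one_mul]
  -- When `x⁻¹ s_b a` is positive: `y > s_a s_b x > s_b x`, along `-s_a b` and then `a`.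
  · obtain ⟨z₂, hz₂, hs₂⟩ := D.exists_step_down (x := y) (b := -refl a b) hb3 (by
      rwa [hy, mul_inv_smul_vec, vec_neg, ← aff_smul_vec, smul_neg, smul_smul, aff_mul_self,
        one_smul, smul_neg, neg_neg])
    have hz₂' : (z₂ : D.ExtAffineWeylGroup) = aff a * (aff b * x) := by
      rw [hz₂, hy, aff_neg, ← aff_mul_aff_mul_aff, mul_assoc, ← mul_assoc (aff a) (aff a),
        aff_mul_self, one_mul, mul_assoc]
    obtain ⟨z₁, hz₁, hs₁⟩ := D.exists_step_down (x := z₂) (b := a) ha (by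
      rw [hz₂', mul_inv_smul_vec, mul_inv_smul_vec, aff_smul_self, smul_neg, smul_neg, neg_neg,
        aff_smul_vec]
      exact hg)
    refine ⟨z₁, .single (hlast z₁ ?_), .tail (.single hs₁) hs₂⟩
    rw [hz₁, hz₂', ← mul_assoc, aff_mul_self, one_mul]

/-! ### Covers in the Bruhat order of the Weyl group -/

theorem reflection_mul_eq (w : D.weylGroup) (β : D.realRoots) :
    D.reflection β * w = w * D.reflection (w⁻¹ • β) := by
  rw [reflection_smul_eq]
  group

theorem length_reflection_mul_lt {β : D.realRoots} (hβ : (β : X) ∈ D.posRoots)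
    {w : D.weylGroup} (h : -(w⁻¹ • (β : X)) ∈ D.posRoots) :
    D.length (D.reflection β * w) < D.length w := by
  rw [reflection_mul_eq, ← reflection_neg]
  refine D.length_mul_reflection_lt h ?_
  rwa [coe_neg_root, coe_smul_root, smul_neg, smul_inv_smul, neg_neg]

theorem length_lt_reflection_mul {β : D.realRoots} (hβ : (β : X) ∈ D.posRoots)
    {w : D.weylGroup} (h : w⁻¹ • (β : X) ∈ D.posRoots) :
    D.length w < D.length (D.reflection β * w) := by
  rw [reflection_mul_eq]
  refine D.length_lt_mul_reflection h ?_
  rwa [coe_smul_root, smul_inv_smul]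

/-- The steps of the Bruhat order in terms of positive roots. -/
theorem exists_pos_of_step {u w : D.weylGroup}
    (h : ∃ β : D.realRoots, w = D.reflection β * u ∧ D.length u < D.length w) :
    ∃ β : D.realRoots, (β : X) ∈ D.posRoots ∧ w = D.reflection β * u ∧
      u⁻¹ • (β : X) ∈ D.posRoots := by
  obtain ⟨β, hw, hl⟩ := h
  obtain ⟨β, hβ, hw⟩ : ∃ β : D.realRoots, (β : X) ∈ D.posRoots ∧ w = D.reflection β * u := by
    rcases D.pos_or_neg β.2 with hp | hp
    · exact ⟨β, hp, hw⟩
    · exact ⟨-β, hp, by rwa [reflection_neg]⟩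
  refine ⟨β, hβ, hw, (D.pos_or_neg (D.smul_mem_realRoots _ β.2)).resolve_right fun hn => ?_⟩
  have := D.length_reflection_mul_lt hβ hn
  rw [← hw] at this
  omega

theorem length_lt_of_bruhatLT {u w : D.weylGroup} (h : D.bruhatLT u w) :
    D.length u < D.length w := by
  induction h with
  | single h => exact h.choose_spec.2
  | tail _ h ih => exact ih.trans h.choose_spec.2

theorem step_of_mem_coversOf {α : Type*} {R : α → α → Prop} {x y : α}
    (h : y ∈ coversOf (Relation.TransGen R) x) : R x y := by
  rcases Relation.TransGen.tail'_iff.1 h.1 with ⟨z, hxz, hzy⟩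
  rcases Relation.reflTransGen_iff_eq_or_transGen.1 hxz with rfl | hxz
  · exact hzy
  · exact absurd ⟨hxz, .single hzy⟩ (h.2 z)

/-- Primitivity of real roots: for even `c`, `β` is a multiple of `γ`; for odd `c`, `γ` is twice an
element of the root lattice. -/
theorem two_smul_ne {β γ : D.realRoots} (h1 : (β : X) ≠ γ) (h2 : (β : X) ≠ -(γ : X)) (c : ℤ) :
    (2 : ℤ) • (β : X) ≠ c • (γ : X) := by
  intro h
  rcases Int.even_or_odd' c with ⟨e, rfl | rfl⟩
  · rw [mul_smul] at h
    have h3 : (β : X) = e • (γ : X) := smul_right_injective X (two_ne_zero (α := ℤ)) h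
    rcases D.eq_one_or_of_eq_smul β.2 (D.realRoot_mem_rootLattice γ.2) h3 with rfl | rfl
    · exact h1 (by simpa using h3)
    · exact h2 (by simpa using h3)
  · have h3 : (γ : X) = (2 : ℤ) • ((β : X) - e • (γ : X)) := by
      rw [smul_sub, h]
      module
    rcases D.eq_one_or_of_eq_smul γ.2 (sub_mem (D.realRoot_mem_rootLattice β.2)
      (Submodule.smul_mem _ _ (D.realRoot_mem_rootLattice γ.2))) h3 with h | h <;> omega

theorem smul_root_inv_smul (w : D.weylGroup) (β : D.realRoots) : w • w⁻¹ • β = β :=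
  Subtype.ext (smul_inv_smul w (β : X))

/-! ### Reflections and intermediate elements in the coordinates `ϖ^{v y} v u` -/

theorem aff_mul_ofPair (v u : D.weylGroup) (y : Y) (γ : D.realRoots) (n : ℤ) :
    aff (D := D) (v • γ, n) * D.ofPair (D.smulY v y) (v * u) =
      D.ofPair (D.smulY v (D.smulY (D.reflection γ) y + n • D.coroot γ))
        (v * (D.reflection γ * u)) := by
  change D.ofPair (n • D.coroot (v • γ)) (D.reflection (v • γ)) * _ = _
  rw [ofPair_mul, coroot_smul, reflection_smul_eq, smulY_add, smulY_zsmul, ← smulY_mul,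
    ← smulY_mul, inv_mul_cancel_right, add_comm]
  congr 1
  group

theorem ofPair_inv_smul (v u : D.weylGroup) (y : Y) (β : D.realRoots) (n : ℤ) :
    (D.ofPair (D.smulY v y) (v * u))⁻¹ • vec (D := D) (v • β, n) =
      vec (D := D) (u⁻¹ • β, n - D.pairing y (β : X)) := by
  refine Prod.ext ?_ ?_
  · rw [affine_inv_smul_fst]
    change (v * u)⁻¹ • v • (β : X) = u⁻¹ • (β : X)
    rw [smul_smul, mul_inv_rev, inv_mul_cancel_right]
  · rw [affine_inv_smul_snd]
    change n - D.pairing (D.smulY v y) (v • (β : X)) = _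
    rw [pairing_smulY_smul]
    rfl

theorem neg_refl_smul (v : D.weylGroup) (γ η : D.realRoots) (n m : ℤ) :
    -refl (D := D) (v • γ, n) (v • η, m) =
      (v • -(D.reflection γ • η), D.pairing (D.coroot γ) (η : X) * n - m) := by
  refine Prod.ext (Subtype.ext ?_) ?_
  · change -(D.reflection (v • γ) • v • (η : X)) = v • -(D.reflection γ • (η : X))
    rw [reflection_smul_eq, smul_neg, smul_smul, smul_smul, inv_mul_cancel_right]
  · change -(m - D.pairing (D.coroot (v • γ)) (v • (η : X)) * n) = _
    rw [coroot_smul, pairing_smulY_smul]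
    ring

/-- The criterion for the existence of an intermediate element, in coordinates. -/
theorem exists_between_ofPair {x z : D.affineWeyl} {v u : D.weylGroup} {y : Y} {γ η : D.realRoots}
    {n m : ℤ} (hx : (x : D.ExtAffineWeylGroup) = D.ofPair (D.smulY v y) (v * u))
    (hz : (z : D.ExtAffineWeylGroup) = aff (D := D) (v • γ, n) * x)
    (ha : D.IsAPos (vec (D := D) (v • γ, n)))
    (ha' : D.IsAPos (vec (D := D) (u⁻¹ • γ, n - D.pairing y (γ : X))))
    (h1 : D.IsAPos (vec (D := D) (v • η, m)))
    (h2 : D.IsAPos (vec (D := D) (u⁻¹ • η, m - D.pairing y (η : X))))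
    (h3 : D.IsAPos (vec (D := D) (v • -(D.reflection γ • η),
      D.pairing (D.coroot γ) (η : X) * n - m)))
    (h4 : D.IsAPos (vec (D := D) (u⁻¹ • -(D.reflection γ • η),
      D.pairing (D.coroot γ) (η : X) * n - m - D.pairing y (-(D.reflection γ • (η : X))))))
    (hne : ((η : X) ≠ γ ∧ (η : X) ≠ -(γ : X)) ∨ (η = γ ∧ m ≠ n)) :
    ∃ t, D.affineBruhatLT x t ∧ D.affineBruhatLT t z := by
  refine D.exists_between (b₀ := (v • η, m)) hz ha ?_ h1 ?_ ?_ ?_ ?_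
  · rwa [hx, ofPair_inv_smul]
  · rwa [hx, ofPair_inv_smul]
  · rwa [neg_refl_smul]
  · rwa [neg_refl_smul, hx, ofPair_inv_smul]
  · have hcp : cp (D := D) (v • γ, n) (vec (D := D) (v • η, m)) = D.pairing (D.coroot γ) (η : X) := by
      change D.pairing (D.coroot (v • γ)) (v • (η : X)) = _
      rw [coroot_smul, pairing_smulY_smul]
    rw [hcp]
    rcases hne with ⟨h1, h2⟩ | ⟨rfl, h⟩
    · intro h
      refine D.two_smul_ne (β := η) (γ := γ) h1 h2 (D.pairing (D.coroot γ) (η : X)) ?_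
      have := congrArg (fun p : X × ℤ => p.1) h
      change (2 : ℤ) • v • (η : X) = D.pairing (D.coroot γ) (η : X) • v • (γ : X) at this
      rw [smul_comm (2 : ℤ) v, smul_comm (D.pairing (D.coroot γ) (η : X)) v] at this
      exact MulAction.injective v this
    · intro h'
      have := congrArg (fun p : X × ℤ => p.2) h'
      change (2 : ℤ) * m = D.pairing (D.coroot η) (η : X) * n at this
      rw [pairing_coroot_self] at this
      omega

/-- Below an element with trivial translation, the reflecting root has height squeezed between 0 and
0, so every descending step takes place in `W^v`. -/
theorem bruhatLT_of_affineBruhatLT {z y : D.affineWeyl} (h : D.affineBruhatLT z y)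
    (hy : (y : D.ExtAffineWeylGroup).left.toAdd = 0) :
    (z : D.ExtAffineWeylGroup).left.toAdd = 0 ∧
      D.bruhatLT (z : D.ExtAffineWeylGroup).right (y : D.ExtAffineWeylGroup).right := by
  have key : ∀ {z y : D.affineWeyl}, D.affineStep z y →
      (y : D.ExtAffineWeylGroup).left.toAdd = 0 →
      (z : D.ExtAffineWeylGroup).left.toAdd = 0 ∧
        D.bruhatLT (z : D.ExtAffineWeylGroup).right (y : D.ExtAffineWeylGroup).right := by
    intro z y hs hy
    obtain ⟨b, hb, hz, hn⟩ := D.affineStep_iff.1 hs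
    have h1 := D.isAPos_nonneg hb
    have h2 := D.isAPos_nonneg hn
    rw [Prod.snd_neg, affine_inv_smul_snd, hy, map_zero, LinearMap.zero_apply] at h2
    change 0 ≤ b.2 at h1
    change 0 ≤ -(b.2 - 0) at h2
    have hb0 : b.2 = 0 := by omega
    have hpos : (b.1 : X) ∈ D.posRoots :=
      (((D.isAPos_vec b).1 hb).resolve_left (by omega)).2
    refine ⟨?_, .single ⟨b.1, ?_, ?_⟩⟩
    · rw [hz, aff_mul_left, hy, hb0, smulY_reflection]
      simp
    · have : D.reflection b.1 * (z : D.ExtAffineWeylGroup).right =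
          (aff b * (z : D.ExtAffineWeylGroup)).right := rfl
      rw [this, hz, ← mul_assoc, aff_mul_self, one_mul]
    · rw [hz]
      refine D.length_reflection_mul_lt hpos ?_
      rcases hn with hn | ⟨-, hn1, -⟩
      · rw [Prod.snd_neg, affine_inv_smul_snd, hy, map_zero, LinearMap.zero_apply] at hn
        change 0 < -(b.2 - 0) at hn
        omega
      · exact ⟨D.neg_mem_realRoots (D.smul_mem_realRoots _ b.1.2), hn1⟩
  induction h using Relation.TransGen.head_induction_on with
  | single hs => exact key hs hy
  | head hs _ ih =>
    obtain ⟨h1, h2⟩ := key hs ih.1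
    exact ⟨h1, h2.trans ih.2⟩

theorem zero_mem_titsCone : (0 : Y) ∈ D.titsCone := ⟨1, 0, fun _ => by simp, by simp⟩

theorem isAPos_mk_zero {β : D.realRoots} (h : (β : X) ∈ D.posRoots) :
    D.IsAPos (vec (D := D) (β, 0)) := (D.isAPos_vec _).2 (Or.inr ⟨rfl, h⟩)

/-- A larger jump in length yields, by `exists_pair_of_length`, a root `η` fit for the affine
criterion at translation zero; the intermediate element then lies in `W^v`. -/
theorem length_le_of_mem_coversOf {u w : D.weylGroup} (h : w ∈ coversOf D.bruhatLT u) :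
    D.length w ≤ D.length u + 1 := by
  obtain ⟨β, hβ, hw, hu⟩ := D.exists_pos_of_step (step_of_mem_coversOf h)
  by_contra! hlt
  have hw' : w = u * D.reflection (u⁻¹ • β) := by rw [hw, reflection_mul_eq]
  have huw : w * D.reflection (u⁻¹ • β) = u := by
    rw [hw', mul_assoc, reflection_mul_self, mul_one]
  have hsw : ∀ t : X, w • t = u • D.reflection (u⁻¹ • β) • t := fun t => by rw [hw', mul_smul]
  obtain ⟨η, hη, hne, h1, h2⟩ := D.exists_pair_of_length (δ := u⁻¹ • β) (w := w) hu
    (by rwa [hsw, reflection_smul_self, smul_neg, neg_neg, coe_smul_root, smul_inv_smul])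
    (by rwa [huw])
  obtain ⟨h3, h4⟩ := D.mem_inv.1 hη
  rw [hsw] at h1
  rw [hsw, reflection_smul_smul] at h2
  have h0 : ∀ w, D.ofPair 0 w ∈ D.affineWeyl := fun w => D.zero_mem_titsCone
  lift η to D.realRoots using h3.1
  obtain ⟨t, ht1, ht2⟩ := D.exists_between_ofPair (x := ⟨_, h0 u⟩) (z := ⟨_, h0 w⟩) (v := u)
    (u := 1) (y := 0) (γ := u⁻¹ • β) (η := η) (n := 0) (m := 0) (by simp [smulY])
    (by
      have := D.aff_mul_ofPair u 1 0 (u⁻¹ • β) 0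
      simp only [smulY_reflection, map_zero, mul_one] at this
      simpa [smulY, hw'] using this.symm)
    (D.isAPos_mk_zero (by rwa [smul_root_inv_smul]))
    (by simpa using D.isAPos_mk_zero (β := (1 : D.weylGroup)⁻¹ • u⁻¹ • β) (by simpa using hu))
    (D.isAPos_mk_zero h2)
    (by simpa using D.isAPos_mk_zero (β := (1 : D.weylGroup)⁻¹ • η) (by simpa using h3))
    (by
      have := D.isAPos_mk_zero (β := u • -(D.reflection (u⁻¹ • β) • η)) (by simpa using h1)
      simpa using this)
    (by
      have := D.isAPos_mk_zero (β := (1 : D.weylGroup)⁻¹ • -(D.reflection (u⁻¹ • β) • η))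
        (by simpa using h4)
      simpa using this)
    (Or.inl ⟨hne, fun h5 => D.not_pos_and_neg h3 (by rw [h5, neg_neg]; exact hu)⟩)
  obtain ⟨h5, h6⟩ := D.bruhatLT_of_affineBruhatLT ht2 rfl
  obtain ⟨-, h7⟩ := D.bruhatLT_of_affineBruhatLT ht1 h5
  exact h.2 _ ⟨h7, h6⟩

theorem finite_length_le (n : ℕ) : {w : D.weylGroup | D.length w ≤ n}.Finite := by
  refine ((List.finite_length_le I n).image fun l => (l.map D.r).prod).subset fun w hw => ?_
  obtain ⟨l, hl, h⟩ := D.exists_reduced w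
  exact ⟨l, hl.trans_le hw, h⟩

theorem finite_coversOf_bruhatLT (u : D.weylGroup) : (coversOf D.bruhatLT u).Finite :=
  (D.finite_length_le (D.length u + 1)).subset fun _ h => D.length_le_of_mem_coversOf h

theorem finite_cocoversOf_bruhatLT (u : D.weylGroup) : (cocoversOf D.bruhatLT u).Finite :=
  (D.finite_length_le (D.length u)).subset fun _ h => (D.length_lt_of_bruhatLT h.1).le

/-! ### Covers in the affine Bruhat order -/

theorem step_up {x z : D.affineWeyl} {b : D.AffRoot} (hb : D.IsAPos (vec b))
    (hx : D.IsAPos ((x : D.ExtAffineWeylGroup)⁻¹ • vec b))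
    (hz : (z : D.ExtAffineWeylGroup) = aff b * x) : D.affineStep x z := by
  refine D.affineStep_iff.2 ⟨b, hb, ?_, ?_⟩
  · rw [hz, ← mul_assoc, aff_mul_self, one_mul]
  · rwa [hz, mul_inv_smul_vec, aff_smul_self, smul_neg, neg_neg]

theorem exists_root_of_step {x z : D.affineWeyl} (h : D.affineStep x z) :
    ∃ b : D.AffRoot, D.IsAPos (vec b) ∧ (z : D.ExtAffineWeylGroup) = aff b * x ∧
      D.IsAPos ((x : D.ExtAffineWeylGroup)⁻¹ • vec b) := by
  obtain ⟨b, hb, hx, hn⟩ := D.affineStep_iff.1 h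
  refine ⟨b, hb, by rw [hx, ← mul_assoc, aff_mul_self, one_mul], ?_⟩
  rwa [hx, mul_inv_smul_vec, aff_smul_self, smul_neg]

/-- If the pairing vanished, `s_δ` would fix `y`, and `v s_δ` would be a shorter representative. -/
theorem pos_of_minimal {y : Y} {v : D.weylGroup} (hy : y ∈ D.dominant) (hv : D.IsMinimalFor y v)
    {δ : D.realRoots} (hδ : (δ : X) ∈ D.posRoots) (h : -(v • (δ : X)) ∈ D.posRoots) :
    0 < D.pairing y (δ : X) := by
  refine lt_of_le_of_ne (D.pairing_nonneg_of_dominant hy hδ.2) fun h0 => ?_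
  have h1 := hv (v * D.reflection δ) (by rw [smulY_mul, smulY_reflection, ← h0]; simp)
  have h2 := D.length_mul_reflection_lt hδ h
  omega

theorem isAPos_mk_pos {β : D.realRoots} {n : ℤ} (h : 0 < n) : D.IsAPos (vec (D := D) (β, n)) :=
  Or.inl h

theorem ofPair_mem_affineWeyl {y : Y} (hy : y ∈ D.dominant) (v w : D.weylGroup) :
    D.ofPair (D.smulY v y) w ∈ D.affineWeyl := ⟨v, y, hy, rfl⟩

theorem affineBruhatLT_of_bruhatLT {y : Y} {v : D.weylGroup} (hy : y ∈ D.dominant)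
    (hv : D.IsMinimalFor y v) {u w : D.weylGroup} (h : D.bruhatLT u w) :
    D.affineBruhatLT ⟨_, D.ofPair_mem_affineWeyl hy v (v * u)⟩
      ⟨_, D.ofPair_mem_affineWeyl hy v (v * w)⟩ := by
  have key : ∀ {u w : D.weylGroup},
      (∃ β : D.realRoots, w = D.reflection β * u ∧ D.length u < D.length w) →
      D.affineStep ⟨_, D.ofPair_mem_affineWeyl hy v (v * u)⟩
        ⟨_, D.ofPair_mem_affineWeyl hy v (v * w)⟩ := by
    intro u w hs
    obtain ⟨β, hβ, hw, hu⟩ := D.exists_pos_of_step hs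
    -- This height makes the reflection preserve the translation `v y`. When it is zero, minimality
    -- of `v` makes `v • β` positive.
    refine D.step_up (b := (v • β, D.pairing y (β : X))) ?_ ?_ ?_
    · rw [isAPos_vec]
      rcases eq_or_lt_of_le (D.pairing_nonneg_of_dominant hy hβ.2) with h0 | h0
      · refine Or.inr ⟨h0.symm, ?_⟩
        refine (D.pos_or_neg (v • β).2).resolve_right fun hn => ?_
        have := D.pos_of_minimal hy hv hβ hn
        omega
      · exact Or.inl h0
    · rw [ofPair_inv_smul, sub_self]
      exact D.isAPos_mk_zero hu
    · change _ = aff _ * D.ofPair _ _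
      rw [aff_mul_ofPair, hw, smulY_reflection, sub_add_cancel]
  induction h with
  | single hs => exact .single (key hs)
  | tail _ hs ih => exact ih.tail (key hs)

/-- The failure of a positive root to be quantum. -/
theorem exists_of_not_isQuantum {β : D.realRoots} (hβ : (β : X) ∈ D.posRoots)
    (h : ¬ D.IsQuantum β) : ∃ η : D.realRoots, (η : X) ∈ D.posRoots ∧ (η : X) ≠ β ∧
      -(D.reflection β • (η : X)) ∈ D.posRoots ∧ 2 ≤ D.pairing (D.coroot β) (η : X) := by
  simp only [IsQuantum, hβ, true_and, not_forall] at h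
  obtain ⟨η, ⟨hη, hne⟩, hc⟩ := h
  have h1 := D.pairing_pos_of_mem_inv hβ hη
  exact ⟨⟨η, hη.1.1⟩, hη.1, hne, hη.2, by change 2 ≤ D.pairing (D.coroot β) η; omega⟩

theorem pairing_neg_reflection_smul (β : D.realRoots) (y : Y) (η : X) :
    D.pairing y (-(D.reflection β • η)) =
      D.pairing (D.coroot β) η * D.pairing y (β : X) - D.pairing y η := by
  rw [reflection_smul, map_neg, map_sub, map_smul, smul_eq_mul]
  ring

section Classification

variable {D} {x z : D.affineWeyl} {y : Y} {v u : D.weylGroup} {γ : D.realRoots} {n : ℤ}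

/-- The covers along a reflection `s_{(v γ, n)}` with `γ` positive. -/
theorem cover_cases_pos (hy : y ∈ D.dominant) (hv : D.IsMinimalFor y v)
    (hx : (x : D.ExtAffineWeylGroup) = D.ofPair (D.smulY v y) (v * u))
    (hz : (z : D.ExtAffineWeylGroup) = aff (D := D) (v • γ, n) * x)
    (ha : D.IsAPos (vec (D := D) (v • γ, n)))
    (ha' : D.IsAPos (vec (D := D) (u⁻¹ • γ, n - D.pairing y (γ : X))))
    (hγ : (γ : X) ∈ D.posRoots)
    (hcov : ∀ t, ¬ (D.affineBruhatLT x t ∧ D.affineBruhatLT t z)) :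
    (∃ w ∈ coversOf D.bruhatLT u, D.ofPair (D.smulY v y) (v * w) = z) ∨
    (∃ β ∈ D.quantumRoots, D.ofPair (D.smulY v (y + D.coroot β)) (v * (D.reflection β * u)) = z) := by
  have hz' := hz
  rw [hx, aff_mul_ofPair, smulY_reflection] at hz'
  have hp := D.pairing_nonneg_of_dominant hy hγ.2
  obtain ⟨p, hpe⟩ : ∃ p, p = D.pairing y (γ : X) := ⟨_, rfl⟩
  rw [← hpe] at hp ha' hz'
  have hnp : 0 ≤ n - p := D.isAPos_nonneg ha'
  rcases eq_or_ne n p with rfl | h0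
  · left
    rw [sub_add_cancel] at hz'
    rw [sub_self, isAPos_vec] at ha'
    have hu : u⁻¹ • (γ : X) ∈ D.posRoots := (ha'.resolve_left (lt_irrefl _)).2
    refine ⟨_, ⟨.single ⟨γ, rfl, D.length_lt_reflection_mul hγ hu⟩, ?_⟩, hz'.symm⟩
    rintro t ⟨h1, h2⟩
    refine hcov ⟨_, D.ofPair_mem_affineWeyl hy v (v * t)⟩ ⟨?_, ?_⟩
    · convert D.affineBruhatLT_of_bruhatLT hy hv h1
    · convert D.affineBruhatLT_of_bruhatLT hy hv h2
  rcases eq_or_ne n (p + 1) with rfl | h1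
  · right
    by_cases hq : D.IsQuantum γ
    · refine ⟨γ, hq, ?_⟩
      rw [hz']
      congr 2
      module
    · exfalso
      obtain ⟨η, hη, hne, hη', hc⟩ := D.exists_of_not_isQuantum hγ hq
      have hyη := D.pairing_nonneg_of_dominant hy hη.2
      have hyη' := D.pairing_nonneg_of_dominant hy hη'.2
      rw [pairing_neg_reflection_smul, ← hpe] at hyη'
      -- Under `x⁻¹` the two roots have heights 1 and `⟨γ^∨, η⟩ - 1`, the latter positive since `γ`
      -- fails to be quantum at `η`. Dominance of `y` makes their original heights at least as
      -- large.
      obtain ⟨t, ht⟩ := D.exists_between_ofPair (η := η) (m := D.pairing y (η : X) + 1) hx hz ha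
        (hpe ▸ ha') (D.isAPos_mk_pos (by omega)) (D.isAPos_mk_pos (by omega))
        (D.isAPos_mk_pos (by nlinarith))
        (D.isAPos_mk_pos (by rw [pairing_neg_reflection_smul, ← hpe]; nlinarith))
        (Or.inl ⟨hne, fun h => D.not_pos_and_neg hγ (h ▸ hη)⟩)
      exact hcov t ht
  · exfalso
    -- Here `n ≥ p + 2`: the roots of direction `v • γ` and heights `n - 1`, `n + 1` are exchanged
    -- by `b ↦ -s_a b`, and both remain positive under `x⁻¹`.
    obtain ⟨t, ht⟩ := D.exists_between_ofPair (η := γ) (m := n - 1) hx hz ha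
      (hpe ▸ ha') (D.isAPos_mk_pos (by omega)) (D.isAPos_mk_pos (by omega))
      (D.isAPos_mk_pos (by rw [pairing_coroot_self]; omega))
      (D.isAPos_mk_pos (by rw [pairing_neg_reflection_smul, pairing_coroot_self]; omega))
      (Or.inr ⟨rfl, by omega⟩)
    exact hcov t ht

/-- The covers along a reflection `s_{(v γ, n)}` with `γ` negative. -/
theorem cover_cases_neg (hy : y ∈ D.dominant) (hv : D.IsMinimalFor y v)
    (hx : (x : D.ExtAffineWeylGroup) = D.ofPair (D.smulY v y) (v * u))
    (hz : (z : D.ExtAffineWeylGroup) = aff (D := D) (v • -γ, n) * x)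
    (ha : D.IsAPos (vec (D := D) (v • -γ, n)))
    (ha' : D.IsAPos (vec (D := D) (u⁻¹ • -γ, n - D.pairing y ((-γ : D.realRoots) : X))))
    (hγ : (γ : X) ∈ D.posRoots)
    (hcov : ∀ t, ¬ (D.affineBruhatLT x t ∧ D.affineBruhatLT t z)) :
    (∃ w ∈ cocoversOf D.bruhatLT v, D.ofPair (D.smulY w y) (w * u) = z) ∨
    (∃ β ∈ D.quantumRoots, D.ofPair (D.smulY (v * D.reflection β) (y + D.coroot β))
      (v * (D.reflection β * u)) = z) := by
  have hz' := hz
  rw [hx, aff_mul_ofPair, reflection_neg, coroot_neg] at hz'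
  have hp := D.pairing_nonneg_of_dominant hy hγ.2
  have hn : 0 ≤ n := D.isAPos_nonneg ha
  have hηpair : ∀ η : D.realRoots, (η : X) ∈ D.posRoots → (η : X) ≠ γ →
      ((-η : D.realRoots) : X) ≠ ((-γ : D.realRoots) : X) ∧
        ((-η : D.realRoots) : X) ≠ -((-γ : D.realRoots) : X) := fun η hη hne =>
    ⟨fun h => hne (neg_injective h), fun h => D.not_pos_and_neg hγ (by
      rw [coe_neg_root, coe_neg_root, neg_neg] at h
      rw [← h, neg_neg]
      exact hη)⟩
  have hcη : ∀ η : D.realRoots, D.pairing (D.coroot (-γ)) ((-η : D.realRoots) : X) =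
      D.pairing (D.coroot γ) (η : X) := fun η => by simp
  have hyη : ∀ η : D.realRoots, D.pairing y (-(D.reflection (-γ) • ((-η : D.realRoots) : X))) =
      -D.pairing y (-(D.reflection γ • (η : X))) := fun η => by simp
  rcases eq_or_ne n 0 with rfl | h0
  · left
    have hvγ : -(v • (γ : X)) ∈ D.posRoots := by
      rw [isAPos_vec] at ha
      simpa using (ha.resolve_left (lt_irrefl _)).2
    have hlt := D.length_mul_reflection_lt hγ hvγ
    refine ⟨v * D.reflection γ, ⟨.single ⟨v • γ, ?_, hlt⟩, ?_⟩, ?_⟩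
    · rw [reflection_smul_eq]
      simp [mul_assoc]
    · rintro t ⟨h1, h2⟩
      have h3 := D.length_lt_of_bruhatLT h1
      have h4 := D.length_lt_of_bruhatLT h2
      -- An element strictly between `v s_γ` and `v` makes the length drop by at least two. The
      -- resulting pair has height 0, and minimality of `v` makes its heights under `x⁻¹` strictly
      -- positive.
      obtain ⟨η, hη, hne, h5, h6⟩ := D.exists_pair_of_length hγ hvγ (by omega)
      obtain ⟨hη1, hη2⟩ := D.mem_inv.1 hη
      lift η to D.realRoots using hη1.1
      have h7 := D.pos_of_minimal hy hv hη1 h5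
      have h8 := D.pos_of_minimal hy hv (δ := -(D.reflection γ • η)) hη2 (by simpa using h6)
      rw [coe_neg_root, coe_smul_root] at h8
      obtain ⟨t, ht⟩ := D.exists_between_ofPair (η := -η) (m := 0) hx hz ha ha'
        (D.isAPos_mk_zero (by simpa using h5))
        (D.isAPos_mk_pos (by rw [coe_neg_root, map_neg]; omega))
        (by
          rw [hcη, mul_zero, sub_zero]
          exact D.isAPos_mk_zero (by simpa using h6))
        (D.isAPos_mk_pos (by rw [hcη, hyη]; omega))
        (Or.inl (hηpair η hη1 hne))
      exact hcov t ht
    · rw [hz', smulY_mul, zero_smul, add_zero, mul_assoc]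
  have hss : D.smulY (D.reflection γ) (y + n • D.coroot γ) =
      D.smulY (D.reflection γ) y + n • -D.coroot γ := by
    simp only [smulY_reflection, map_add, map_smul, LinearMap.add_apply, LinearMap.smul_apply,
      pairing_coroot_self, smul_eq_mul]
    module
  rcases eq_or_ne n 1 with rfl | h1
  · right
    by_cases hq : D.IsQuantum γ
    · refine ⟨γ, hq, ?_⟩
      rw [hz', ← hss, one_smul, smulY_mul]
    · exfalso
      obtain ⟨η, hη, hne, hη', hc⟩ := D.exists_of_not_isQuantum hγ hq
      have h7 := D.pairing_nonneg_of_dominant hy hη.2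
      have h8 := D.pairing_nonneg_of_dominant hy hη'.2
      -- The heights of the pair are now 1 and `⟨γ^∨, η⟩ - 1`; applying `x⁻¹` adds the nonnegative
      -- values of `y` on `η` and on `-s_γ η`.
      obtain ⟨t, ht⟩ := D.exists_between_ofPair (η := -η) (m := 1) hx hz ha ha'
        (D.isAPos_mk_pos one_pos) (D.isAPos_mk_pos (by rw [coe_neg_root, map_neg]; omega))
        (D.isAPos_mk_pos (by rw [hcη]; omega)) (D.isAPos_mk_pos (by rw [hcη, hyη]; omega))
        (Or.inl (hηpair η hη hne))
      exact hcov t ht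
  · exfalso
    have hyγ : D.pairing y ((-γ : D.realRoots) : X) = -D.pairing y (γ : X) := by simp
    obtain ⟨t, ht⟩ := D.exists_between_ofPair (η := -γ) (m := n - 1) hx hz ha ha'
      (D.isAPos_mk_pos (by omega)) (D.isAPos_mk_pos (by rw [hyγ]; omega))
      (D.isAPos_mk_pos (by rw [pairing_coroot_self]; omega))
      (D.isAPos_mk_pos (by
        rw [pairing_neg_reflection_smul, pairing_coroot_self, hyγ]
        omega))
      (Or.inr ⟨rfl, by omega⟩)
    exact hcov t ht

end Classification

/-- A cover is a single reflection step, and its root can be written `(v • γ, n)`; the sign of `γ`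
selects the classification lemma, each contributing one quantum family and one Bruhat family. -/
theorem image_coversOf_subset {x : D.affineWeyl} {y : Y} {v w : D.weylGroup}
    (h : D.IsDecomposition x y v w) :
    Subtype.val '' coversOf D.affineBruhatLT x ⊆
      (((fun β : D.realRoots => D.ofPair (D.smulY v (y + D.coroot β))
          (v * (D.reflection β * (v⁻¹ * w)))) '' D.quantumRoots) ∪
        ((fun β : D.realRoots => D.ofPair (D.smulY (v * D.reflection β) (y + D.coroot β))
          (v * (D.reflection β * (v⁻¹ * w)))) '' D.quantumRoots)) ∪
      ((fun t => D.ofPair (D.smulY v y) (v * t)) '' coversOf D.bruhatLT (v⁻¹ * w)) ∪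
      ((fun t => D.ofPair (D.smulY t y) (t * (v⁻¹ * w))) '' cocoversOf D.bruhatLT v) := by
  rintro _ ⟨z, hz, rfl⟩
  obtain ⟨hy, hv, hx⟩ := h
  rw [← mul_inv_cancel_left v w] at hx
  obtain ⟨⟨β, n⟩, hb, hzx, hb'⟩ := D.exists_root_of_step (step_of_mem_coversOf hz)
  obtain ⟨γ, rfl⟩ : ∃ γ : D.realRoots, β = v • γ := ⟨_, (D.smul_root_inv_smul v β).symm⟩
  rw [hx, ofPair_inv_smul] at hb'
  rcases D.pos_or_neg γ.2 with hγ | hγ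
  · rcases cover_cases_pos hy hv hx hzx hb hb' hγ hz.2 with h | h
    · exact Or.inl (Or.inr h)
    · exact Or.inl (Or.inl (Or.inl h))
  · obtain ⟨δ, rfl⟩ : ∃ δ : D.realRoots, γ = -δ := ⟨-γ, Subtype.ext (neg_neg (γ : X)).symm⟩
    rw [coe_neg_root, neg_neg] at hγ
    rcases cover_cases_neg hy hv hx hzx hb hb' hγ hz.2 with h | h
    · exact Or.inr h
    · exact Or.inl (Or.inl (Or.inr h))

theorem exists_decomposition (x : D.affineWeyl) :
    ∃ (y : Y) (v w : D.weylGroup), D.IsDecomposition x y v w := by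
  obtain ⟨w₀, y, hy, hx⟩ := x.2
  obtain ⟨v, hv, hmin⟩ : ∃ v, D.smulY v y = D.smulY w₀ y ∧
      ∀ u, D.smulY u y = D.smulY w₀ y → D.length v ≤ D.length u := by
    have hwf := (measure D.length).wf
    obtain ⟨v, hv, hmin⟩ := hwf.has_min {u | D.smulY u y = D.smulY w₀ y} ⟨w₀, rfl⟩
    exact ⟨v, hv, fun u hu => not_lt.1 (hmin u hu)⟩
  refine ⟨y, v, (x : D.ExtAffineWeylGroup).right, hy, fun u hu => hmin u (hu.trans hv), ?_⟩
  refine SemidirectProduct.ext ?_ rfl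
  exact congrArg Multiplicative.ofAdd (hx.trans hv.symm)

theorem finite_and_ncard_coversOf_le {x : D.affineWeyl} {y : Y} {v w : D.weylGroup}
    (h : D.IsDecomposition x y v w) :
    (coversOf D.affineBruhatLT x).Finite ∧ (coversOf D.affineBruhatLT x).ncard ≤
      2 * D.quantumRoots.ncard + (coversOf D.bruhatLT (v⁻¹ * w)).ncard +
        (cocoversOf D.bruhatLT v).ncard := by
  have hsub := D.image_coversOf_subset h
  have hQ := D.finite_quantumRoots
  have hA := D.finite_coversOf_bruhatLT (v⁻¹ * w)
  have hB := D.finite_cocoversOf_bruhatLT v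
  have hfin := (((hQ.image fun β => D.ofPair (D.smulY v (y + D.coroot β))
    (v * (D.reflection β * (v⁻¹ * w)))).union
      (hQ.image fun β => D.ofPair (D.smulY (v * D.reflection β) (y + D.coroot β))
        (v * (D.reflection β * (v⁻¹ * w))))).union
      (hA.image fun t => D.ofPair (D.smulY v y) (v * t))).union
      (hB.image fun t => D.ofPair (D.smulY t y) (t * (v⁻¹ * w)))
  refine ⟨Set.Finite.of_finite_image (hfin.subset hsub) Subtype.val_injective.injOn, ?_⟩
  rw [← Set.ncard_image_of_injective _ Subtype.val_injective]
  refine (Set.ncard_le_ncard hsub hfin).trans ((Set.ncard_union_le _ _).trans ?_)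
  refine add_le_add ((Set.ncard_union_le _ _).trans (add_le_add ?_ (Set.ncard_image_le hA)))
    (Set.ncard_image_le hB)
  rw [two_mul]
  exact (Set.ncard_union_le _ _).trans (add_le_add (Set.ncard_image_le hQ) (Set.ncard_image_le hQ))

end KacMoodyRootDatum

theorem mainTheorem3 {I X Y : Type*} [Finite I]
    [AddCommGroup X] [Module.Free ℤ X] [Module.Finite ℤ X]
    [AddCommGroup Y] [Module.Free ℤ Y] [Module.Finite ℤ Y]
    (D : KacMoodyRootDatum I X Y) (x : D.affineWeyl) :
    (coversOf D.affineBruhatLT x).Finite ∧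
    D.quantumRoots.Finite ∧
    (∀ u : D.weylGroup,
      (coversOf D.bruhatLT u).Finite ∧ (cocoversOf D.bruhatLT u).Finite) ∧
    (∃ (y : Y) (v w : D.weylGroup), D.IsDecomposition x y v w) ∧
    ∀ (y : Y) (v w : D.weylGroup), D.IsDecomposition x y v w →
      (coversOf D.affineBruhatLT x).ncard ≤
        2 * D.quantumRoots.ncard + (coversOf D.bruhatLT (v⁻¹ * w)).ncard +
          (cocoversOf D.bruhatLT v).ncard := by
  refine ⟨?_, D.finite_quantumRoots, fun u => ⟨D.finite_coversOf_bruhatLT u,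
    D.finite_cocoversOf_bruhatLT u⟩, D.exists_decomposition x, fun y v w h =>
      (D.finite_and_ncard_coversOf_le h).2⟩
  obtain ⟨y, v, w, h⟩ := D.exists_decomposition x
  exact (D.finite_and_ncard_coversOf_le h).1
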